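/- Let $n\ge 1$, $k\ge 2$ be integers and $\varepsilon\in(0,1]$, and write $d_{TV}(P,Q)=\frac12\sum_{i=1}^n|P(i)-Q(i)|$ for probability distributions $P,Q$ on $[n]=\{1,\dots,n\}$. For every constant $c>0$ there is a constant $C>0$, depending only on $c$, such that for all such $n,k,\varepsilon$ the following holds. There exists a (possibly randomised) procedure, which may depend on $n,k,\varepsilon$ and $c$ but not on $P,Q,D_1,\dots,D_k$, that draws $s_1$ independent samples from each of $P$ and $Q$ and $s_2$ independent samples from each of $D_1,\dots,D_k$, and then labels each index $i\in[k]$ by "$P$" or "$Q$", with the following two properties. (1) For all distributions $P,Q$ on $[n]$ with $c\,d_{TV}(P,Q)\ge\varepsilon$ and all $D_1,\dots,D_k$ with $D_i\in\{P,Q\}$ for every $i$, with probability at least $\frac89$ all $k$ labels are simultaneously correct. (2) The total number of samples $T=2s_1+ks_2$ satisfies (with $\log$ the natural logarithm) - $T\le C\left(\frac{n^2k\log k}{\varepsilon^4}\right)^{1/3}$ if $c\,n\ge\frac{k\log k}{\varepsilon^4}$; - $T\le C\,\frac{\sqrt{nk\log k}}{\varepsilon^2}$ if $c\,n\ge k\log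 k$ and $n\le c\,\frac{k\log k}{\varepsilon^4}$; - $T\le C\,\frac{k\log k}{\varepsilon^2}$ if $n\le c\,k\log k$. -/

import Mathlib

open MeasureTheory

/-- Total variation distance of two distributions on `[n]`: half the `ℓ¹` distance. -/
noncomputable def tvDist {n : ℕ} (P Q : PMF (Fin n)) : ℝ :=
  (1 / 2) * ∑ i, |(P i).toReal - (Q i).toReal|

/-- A (possibly randomised) procedure with sample access to `P`, `Q` and `D₁, …, Dₖ`, all on `[n]`.
It draws `s₁` samples from `P`, `s₁` samples from `Q` and `s₂` samples from each `Dᵢ`, and outputs a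
random labelling of `[k]`, whose law is a function of the samples seen and nothing else.
The label `true` means `P`, the label `false` means `Q`. -/
structure ClassificationProcedure (n k : ℕ) where
  /-- number of samples drawn from each of `P` and `Q` -/
  s₁ : ℕ
  /-- number of samples drawn from each `Dᵢ` -/
  s₂ : ℕ
  /-- law of the output, given the samples from `P`, from `Q` and from the `Dᵢ` -/
  rule : (Fin s₁ → Fin n) → (Fin s₁ → Fin n) → (Fin k → Fin s₂ → Fin n) → PMF (Fin k → Bool)

namespace ClassificationProcedure

variable {n k : ℕ}

/-- The total number of samples drawn, from all `k + 2` distributions together. -/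
def sampleCount (A : ClassificationProcedure n k) : ℕ :=
  2 * A.s₁ + k * A.s₂

/-- The joint law `P^{⊗ s₁} ⊗ Q^{⊗ s₁} ⊗ ⨂ᵢ Dᵢ^{⊗ s₂}` of all samples (all independent). -/
noncomputable def sampleLaw (A : ClassificationProcedure n k) (P Q : PMF (Fin n))
    (D : Fin k → PMF (Fin n)) :
    Measure ((Fin A.s₁ → Fin n) × (Fin A.s₁ → Fin n) × (Fin k → Fin A.s₂ → Fin n)) :=
  (Measure.pi fun _ : Fin A.s₁ => P.toMeasure).prod
    ((Measure.pi fun _ : Fin A.s₁ => Q.toMeasure).prod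
      (Measure.pi fun i : Fin k => Measure.pi fun _ : Fin A.s₂ => (D i).toMeasure))

/-- The probability, over the samples and the internal randomness, that all `k` labels are right. -/
noncomputable def successProb (A : ClassificationProcedure n k) (P Q : PMF (Fin n))
    (D : Fin k → PMF (Fin n)) : ENNReal :=
  ∫⁻ ω, (A.rule ω.1 ω.2.1 ω.2.2).toMeasure {σ | ∀ i, D i = if σ i = true then P else Q}
    ∂(A.sampleLaw P Q D)

end ClassificationProcedure

/-!
Match the reference samples from `P` and `Q` up to `N` pairs, three times over. The counts of the
first `N` pairs give flattening weights `w i`, of order `1 / (1 + M * (P i + Q i))` with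
`M = min N n`. The second `N` pairs give frequency differences `d i`, and `w i * d i` is a score
whose means under `P` and `Q` differ by about `S = ∑ i, (P i - Q i) ^ 2 / (1 + M * (P i + Q i))`;
the third `N` pairs locate the midpoint of these means. The score has second moment of order
`S / M + 1 / (N * M)`, so by Chebyshev's inequality `m` samples from `D i` identify it with constant
probability as soon as `m * M * S` and `m * N * M * S ^ 2` are large; a majority vote over
`O(log k)` blocks of `m` samples then makes all labels right.

By the Cauchy–Schwarz inequality, `S` is at least of order `ε ^ 2 / n`. With `m = N / (k * log k)`,
which makes the total number of samples of order `N`, the two conditions hold once `N` exceeds a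
multiple of the largest of the three bounds of the theorem, and in each regime its own bound is the
largest one up to constants.
-/

open ProbabilityTheory

section EmpiricalMeans

variable {α : Type*}

/-- The empirical mean of `g` over the sample `x`. -/
noncomputable def empMean {N : ℕ} (g : α → ℝ) (x : Fin N → α) : ℝ :=
  (∑ j, g (x j)) / N

variable [MeasurableSpace α] {μ : Measure α} [IsProbabilityMeasure μ]

theorem integral_sum_eval (N : ℕ) {g : α → ℝ} (hg : Integrable g μ) :
    ∫ x, ∑ j, g (x j) ∂(Measure.pi fun _ : Fin N => μ) = N * ∫ a, g a ∂μ := by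
  have h (j : Fin N) : ∫ x, g (x j) ∂(Measure.pi fun _ : Fin N => μ) = ∫ a, g a ∂μ :=
    integral_comp_eval (μ := fun _ : Fin N => μ) hg.aestronglyMeasurable
  rw [integral_finsetSum _ fun _ _ => integrable_comp_eval hg]
  simp only [h, Finset.sum_const, Finset.card_univ, Fintype.card_fin, nsmul_eq_mul]

theorem integral_empMean {N : ℕ} (hN : N ≠ 0) {g : α → ℝ} (hg : Integrable g μ) :
    ∫ x, empMean g x ∂(Measure.pi fun _ : Fin N => μ) = ∫ a, g a ∂μ := by
  simp only [empMean, integral_div, integral_sum_eval N hg]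
  field_simp

theorem memLp_empMean (N : ℕ) {g : α → ℝ} (hg : MemLp g 2 μ) :
    MemLp (empMean g) 2 (Measure.pi fun _ : Fin N => μ) := by
  change MemLp (fun x : Fin N → α => (∑ j, g (x j)) / N) 2 _
  simp only [div_eq_mul_inv]
  exact (memLp_finsetSum _ fun j _ =>
    hg.comp_measurePreserving (measurePreserving_eval (fun _ : Fin N => μ) j)).mul_const _

theorem variance_empMean (N : ℕ) {g : α → ℝ} (hg : MemLp g 2 μ) :
    Var[empMean g; Measure.pi fun _ : Fin N => μ] = Var[g; μ] / N := by
  have h : (empMean g : (Fin N → α) → ℝ) = fun x => (N : ℝ)⁻¹ * (∑ j, fun ω => g (ω j)) x := by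
    funext x
    simp [empMean, div_eq_inv_mul]
  rw [h, variance_const_mul, variance_sum_pi (X := fun _ : Fin N => g) fun _ => hg]
  rcases eq_or_ne N 0 with rfl | hN
  · simp
  · simp
    field_simp

theorem variance_le_integral_sq {g : α → ℝ} (hg : AEStronglyMeasurable g μ) :
    Var[g; μ] ≤ ∫ a, g a ^ 2 ∂μ := by
  simpa using variance_le_expectation_sq hg

theorem measureReal_le_abs_empMean_sub_le {N : ℕ} (hN : N ≠ 0) {g : α → ℝ} (hg : MemLp g 2 μ)
    {c : ℝ} (hc : 0 < c) :
    (Measure.pi fun _ : Fin N => μ).real {x | c ≤ |empMean g x - ∫ a, g a ∂μ|}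
      ≤ Var[g; μ] / (N * c ^ 2) := by
  have h := meas_ge_le_variance_div_sq (memLp_empMean N hg) hc
  rw [integral_empMean hN (hg.integrable one_le_two), variance_empMean N hg, div_div] at h
  exact ENNReal.toReal_le_of_le_ofReal (by have := variance_nonneg g μ; positivity) h

end EmpiricalMeans

section Tails

variable {α β : Type*} [MeasurableSpace α] [MeasurableSpace β]

theorem measureReal_le_of_integral_le {μ : Measure α} {f : α → ℝ}
    (hf : 0 ≤ f) (hint : Integrable f μ) {t b : ℝ} (ht : 0 < t) (h : ∫ a, f a ∂μ ≤ t * b) :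
    μ.real {a | t ≤ f a} ≤ b :=
  le_of_mul_le_mul_left ((mul_meas_ge_le_integral_of_nonneg (ae_of_all _ hf) hint t).trans h) ht

theorem measureReal_prod_le {μ : Measure α} {ν : Measure β} [IsProbabilityMeasure μ]
    [IsProbabilityMeasure ν] {G : Set α} (hG : MeasurableSet G) {B : Set (α × β)}
    (hB : MeasurableSet B) {a b : ℝ} (hb : 0 ≤ b) (hGa : μ.real Gᶜ ≤ a)
    (hBb : ∀ x ∈ G, ν.real (Prod.mk x ⁻¹' B) ≤ b) : (μ.prod ν).real B ≤ a + b := by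
  have hslice : Integrable (fun x => ν.real (Prod.mk x ⁻¹' B)) μ :=
    .of_mem_Icc 0 1 (measurable_measure_prodMk_left hB).ennreal_toReal.aemeasurable
      (ae_of_all _ fun _ => ⟨measureReal_nonneg, measureReal_le_one⟩)
  have hind : Integrable (Gᶜ.indicator (1 : α → ℝ)) μ := (integrable_const 1).indicator hG.compl
  calc (μ.prod ν).real B = ∫ x, ν.real (Prod.mk x ⁻¹' B) ∂μ := by
        rw [measureReal_def, Measure.prod_apply hB]
        exact (integral_toReal (measurable_measure_prodMk_left hB).aemeasurable
          (ae_of_all _ fun _ => measure_lt_top _ _)).symm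
    _ ≤ ∫ x, (Gᶜ.indicator 1 x + b) ∂μ := by
        refine integral_mono hslice (hind.add (integrable_const b)) fun x => ?_
        by_cases hx : x ∈ G
        · simpa [hx] using hBb x hx
        · have : ν.real (Prod.mk x ⁻¹' B) ≤ 1 := measureReal_le_one
          simpa [hx] using this.trans (le_add_of_nonneg_right hb)
    _ = μ.real Gᶜ + b := by
        rw [integral_add hind (integrable_const b), integral_indicator_one hG.compl]
        simp
    _ ≤ a + b := by gcongr

/-- By Markov's inequality for `t ^ (2 * number of failures)`. -/
theorem measureReal_half_fail_le {π : Measure β} [IsProbabilityMeasure π] {B : β → Prop}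
    [DecidablePred B] (hB : MeasurableSet {b | B b}) {t : ℝ} (ht : 1 ≤ t)
    (hBt : t ^ 2 * π.real {b | B b} ≤ 1) (L : ℕ) :
    (Measure.pi fun _ : Fin L => π).real {z | L ≤ 2 * Finset.card {l | B (z l)}}
      ≤ (2 / t) ^ L := by
  let e : β → ℝ := fun b => if B b then t ^ 2 else 1
  have hprod (z : Fin L → β) : (t ^ 2) ^ Finset.card {l | B (z l)} = ∏ l, e (z l) := by
    simp [e, Finset.prod_ite]
  have he : e = fun b => 1 + (t ^ 2 - 1) * {b | B b}.indicator 1 b := by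
    funext b
    by_cases hb : B b <;> simp [e, hb]
  have hint : Integrable ({b | B b}.indicator (1 : β → ℝ)) π := (integrable_const 1).indicator hB
  have he2 : ∫ b, e b ∂π ≤ 2 := by
    rw [he, integral_add (integrable_const 1) (hint.const_mul _), integral_const_mul,
      integral_indicator_one hB]
    have := measureReal_nonneg (μ := π) (s := {b | B b})
    simp only [integral_const, probReal_univ, smul_eq_mul, mul_one]
    linarith
  have hmoment : ∫ z, (t ^ 2) ^ Finset.card {l | B (z l)} ∂(Measure.pi fun _ : Fin L => π)
      ≤ t ^ L * (2 / t) ^ L := by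
    simp only [hprod]
    rw [integral_fintype_prod_eq_pow, Fintype.card_fin, ← mul_pow,
      mul_div_cancel₀ _ (by positivity)]
    exact pow_le_pow_left₀ (integral_nonneg fun b => by simp only [e]; split_ifs <;> positivity)
      he2 L
  refine (measureReal_mono ?_).trans (measureReal_le_of_integral_le (fun z => by positivity) ?_
    (by positivity : 0 < t ^ L) hmoment)
  · intro z hz
    rw [Set.mem_ofPred_eq] at hz ⊢
    rw [← pow_mul]
    exact pow_le_pow_right₀ ht hz
  · simp only [hprod]
    exact .fintype_prod fun _ => he ▸ (integrable_const 1).add (hint.const_mul (t ^ 2 - 1))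

end Tails

section Flattening

variable {α : Type*}

/-- The number of occurrences of `i` in a sample of pairs, counting both coordinates. -/
noncomputable def pairCount {N : ℕ} (z : Fin N → α × α) (i : α) : ℝ :=
  ∑ j, (({i} : Set α).indicator 1 (z j).1 + ({i} : Set α).indicator 1 (z j).2)

/-- The flattening weight of `i`. The rate `r ≤ 1` damps the counts when the sample is larger than
the domain. -/
noncomputable def flatWeight {N : ℕ} (r : ℝ) (z : Fin N → α × α) (i : α) : ℝ :=
  1 / (1 + r * pairCount z i)

theorem pairCount_nonneg {N : ℕ} (z : Fin N → α × α) (i : α) : 0 ≤ pairCount z i :=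
  Finset.sum_nonneg fun _ _ => add_nonneg (Set.indicator_nonneg (by simp) _)
    (Set.indicator_nonneg (by simp) _)

theorem flatWeight_pos {N : ℕ} {r : ℝ} (hr : 0 ≤ r) (z : Fin N → α × α) (i : α) :
    0 < flatWeight r z i := by
  have := pairCount_nonneg z i
  unfold flatWeight
  positivity

theorem flatWeight_le_one {N : ℕ} {r : ℝ} (hr : 0 ≤ r) (z : Fin N → α × α) (i : α) :
    flatWeight r z i ≤ 1 :=
  div_le_one_of_le₀ (le_add_of_nonneg_right (mul_nonneg hr (pairCount_nonneg z i)))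
    (add_nonneg zero_le_one (mul_nonneg hr (pairCount_nonneg z i)))

theorem sq_one_div_one_add_mul_le {r m x : ℝ} (hr : 0 < r) (hm : 0 < m) (hx : 0 ≤ x) :
    (1 / (1 + r * x)) ^ 2 ≤ 16 / (r * m) ^ 2 + Real.exp (m / 4) * Real.exp (-x) := by
  rcases le_or_gt (m / 4) x with h | h
  · have hle : 1 / (1 + r * x) ≤ 4 / (r * m) := by
      rw [div_le_div_iff₀ (by positivity) (by positivity)]
      nlinarith
    calc (1 / (1 + r * x)) ^ 2 ≤ (4 / (r * m)) ^ 2 := by gcongr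
      _ = 16 / (r * m) ^ 2 := by ring
      _ ≤ _ := le_add_of_nonneg_right (by positivity)
  · have hle : 1 / (1 + r * x) ≤ 1 :=
      div_le_one_of_le₀ (le_add_of_nonneg_right (by positivity)) (by positivity)
    calc (1 / (1 + r * x)) ^ 2 ≤ 1 := pow_le_one₀ (by positivity) hle
      _ ≤ Real.exp (m / 4) * Real.exp (-x) := by
          rw [← Real.exp_add]
          exact Real.one_le_exp (by linarith)
      _ ≤ _ := le_add_of_nonneg_left (by positivity)

variable [MeasurableSpace α] [MeasurableSingletonClass α] {μ ν : Measure α}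
  [IsProbabilityMeasure μ] [IsProbabilityMeasure ν]

theorem measurable_pairCount (N : ℕ) (i : α) :
    Measurable fun z : Fin N → α × α => pairCount z i := by
  have h : Measurable (({i} : Set α).indicator (1 : α → ℝ)) :=
    measurable_one.indicator (measurableSet_singleton i)
  unfold pairCount
  fun_prop

theorem integral_pairCount (N : ℕ) (i : α) :
    ∫ z, pairCount z i ∂(Measure.pi fun _ : Fin N => μ.prod ν)
      = N * (μ.real {i} + ν.real {i}) := by
  have hi (ρ : Measure α) [IsProbabilityMeasure ρ] :
      Integrable (({i} : Set α).indicator (1 : α → ℝ)) ρ :=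
    (integrable_const 1).indicator (measurableSet_singleton i)
  simp only [pairCount]
  rw [integral_sum_eval N
      (g := fun p : α × α => ({i} : Set α).indicator 1 p.1 + ({i} : Set α).indicator 1 p.2)
      (((hi μ).comp_fst ν).add ((hi ν).comp_snd μ)),
    integral_add ((hi μ).comp_fst ν) ((hi ν).comp_snd μ), integral_fun_fst, integral_fun_snd]
  simp [integral_indicator_one]

theorem integral_exp_neg_indicator_le (i : α) :
    ∫ a, Real.exp (-({i} : Set α).indicator 1 a) ∂μ ≤ Real.exp (-(μ.real {i} / 2)) := by
  have hexp (a : α) : Real.exp (-({i} : Set α).indicator 1 a)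
      = 1 - (1 - Real.exp (-1)) * ({i} : Set α).indicator 1 a := by
    by_cases h : a = i <;> simp [h]
  have he : Real.exp (-1) ≤ 1 / 2 := by
    rw [Real.exp_neg, one_div]
    exact inv_anti₀ two_pos (by linarith [Real.add_one_le_exp 1])
  simp only [hexp]
  rw [integral_sub (integrable_const 1)
      (((integrable_const 1).indicator (measurableSet_singleton i)).const_mul _),
    integral_const_mul, integral_indicator_one (measurableSet_singleton i)]
  calc _ ≤ 1 - μ.real {i} / 2 := by
        have := measureReal_nonneg (μ := μ) (s := {i})
        simp only [integral_const, probReal_univ, smul_eq_mul, mul_one]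
        nlinarith
    _ ≤ _ := Real.one_sub_le_exp_neg _

theorem integral_exp_neg_pairCount_le (N : ℕ) (i : α) :
    ∫ z, Real.exp (-pairCount z i) ∂(Measure.pi fun _ : Fin N => μ.prod ν)
      ≤ Real.exp (-(N * (μ.real {i} + ν.real {i}) / 2)) := by
  have hprod (z : Fin N → α × α) : Real.exp (-pairCount z i)
      = ∏ j, Real.exp (-({i} : Set α).indicator 1 (z j).1)
          * Real.exp (-({i} : Set α).indicator 1 (z j).2) := by
    simp only [pairCount, ← Finset.sum_neg_distrib, Real.exp_sum, neg_add, Real.exp_add]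
  simp only [hprod]
  rw [integral_fintype_prod_eq_pow (ι := Fin N) (μ := μ.prod ν) fun p : α × α =>
      Real.exp (-({i} : Set α).indicator 1 p.1) * Real.exp (-({i} : Set α).indicator 1 p.2),
    integral_prod_mul (fun a => Real.exp (-({i} : Set α).indicator 1 a))
      fun a => Real.exp (-({i} : Set α).indicator 1 a), Fintype.card_fin]
  calc _ ≤ (Real.exp (-(μ.real {i} / 2)) * Real.exp (-(ν.real {i} / 2))) ^ N := by
        have : 0 ≤ ∫ a, Real.exp (-({i} : Set α).indicator 1 a) ∂ν :=
          integral_nonneg fun _ => (Real.exp_pos _).le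
        gcongr <;> exact integral_exp_neg_indicator_le i
    _ = _ := by rw [← Real.exp_add, ← Real.exp_nat_mul]; ring_nf

theorem integrable_flatWeight_sq (N : ℕ) {r : ℝ} (hr : 0 ≤ r) (i : α) :
    Integrable (fun z => flatWeight r z i ^ 2) (Measure.pi fun _ : Fin N => μ.prod ν) := by
  refine .of_mem_Icc 0 1 ?_ (ae_of_all _ fun z =>
    ⟨sq_nonneg _, pow_le_one₀ (flatWeight_pos hr z i).le (flatWeight_le_one hr z i)⟩)
  have := measurable_pairCount N i
  unfold flatWeight
  fun_prop

theorem integral_flatWeight_sq_le_add (N : ℕ) {r m : ℝ} (hr : 0 < r) (hm : 0 < m)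
    {i : α} (hmi : m = N * (μ.real {i} + ν.real {i})) :
    ∫ z, flatWeight r z i ^ 2 ∂(Measure.pi fun _ : Fin N => μ.prod ν)
      ≤ 16 / (r * m) ^ 2 + Real.exp (-(m / 4)) := by
  have hexp : Integrable (fun z => Real.exp (-pairCount z i))
      (Measure.pi fun _ : Fin N => μ.prod ν) :=
    .of_mem_Icc 0 1 (measurable_pairCount N i).neg.exp.aemeasurable (ae_of_all _ fun z =>
      ⟨(Real.exp_pos _).le, Real.exp_le_one_iff.2 (neg_nonpos.2 (pairCount_nonneg z i))⟩)
  calc _ ≤ ∫ z, (16 / (r * m) ^ 2 + Real.exp (m / 4) * Real.exp (-pairCount z i))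
          ∂(Measure.pi fun _ : Fin N => μ.prod ν) :=
        integral_mono (integrable_flatWeight_sq N hr.le i)
          ((integrable_const _).add (hexp.const_mul _))
          fun z => sq_one_div_one_add_mul_le hr hm (pairCount_nonneg z i)
    _ = 16 / (r * m) ^ 2 + Real.exp (m / 4)
          * ∫ z, Real.exp (-pairCount z i) ∂(Measure.pi fun _ : Fin N => μ.prod ν) := by
        rw [integral_add (integrable_const _) (hexp.const_mul _), integral_const_mul]
        simp
    _ ≤ 16 / (r * m) ^ 2 + Real.exp (m / 4) * Real.exp (-(m / 2)) := by
        rw [hmi]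
        gcongr
        exact integral_exp_neg_pairCount_le N i
    _ = _ := by rw [← Real.exp_add]; ring_nf

theorem integral_flatWeight_sq_le (N : ℕ) {r : ℝ} (hr : 0 < r) (hr1 : r ≤ 1) (i : α) :
    ∫ z, flatWeight r z i ^ 2 ∂(Measure.pi fun _ : Fin N => μ.prod ν)
      ≤ 192 / (1 + r * N * (μ.real {i} + ν.real {i})) ^ 2 := by
  set m : ℝ := N * (μ.real {i} + ν.real {i}) with hm
  have hm0 : 0 ≤ m := by positivity
  rw [mul_assoc, ← hm]
  rcases le_or_gt (r * m) 1 with h | h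
  · calc _ ≤ ∫ _, (1 : ℝ) ∂(Measure.pi fun _ : Fin N => μ.prod ν) :=
          integral_mono (integrable_flatWeight_sq N hr.le i) (integrable_const 1) fun z =>
            pow_le_one₀ (flatWeight_pos hr.le z i).le (flatWeight_le_one hr.le z i)
      _ = 1 := by simp
      _ ≤ _ := by
          have : 0 ≤ r * m := by positivity
          rw [le_div_iff₀ (by positivity)]
          nlinarith
  · have hm_pos : 0 < m := pos_of_mul_pos_right (one_pos.trans h) hr.le
    have hexp : Real.exp (-(m / 4)) ≤ 32 / (r * m) ^ 2 :=
      calc Real.exp (-(m / 4)) = (Real.exp (m / 4))⁻¹ := Real.exp_neg _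
        _ ≤ ((m / 4) ^ 2 / 2)⁻¹ := by
            gcongr
            linarith [Real.quadratic_le_exp_of_nonneg (x := m / 4) (by positivity)]
        _ = 32 / m ^ 2 := by field_simp; norm_num
        _ ≤ 32 / (r * m) ^ 2 := by
            gcongr
            exact mul_le_of_le_one_left hm0 hr1
    calc _ ≤ 16 / (r * m) ^ 2 + 32 / (r * m) ^ 2 := by
          grw [← hexp]
          exact integral_flatWeight_sq_le_add N hr hm_pos hm
      _ ≤ 192 / (1 + r * m) ^ 2 := by
          rw [← add_div, div_le_div_iff₀ (by positivity) (by positivity)]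
          nlinarith

theorem mul_integral_flatWeight_sq_le (N : ℕ) {r : ℝ} (hr : 0 < r) (hr1 : r ≤ 1) (i : α) :
    r * N * (μ.real {i} + ν.real {i})
        * ∫ z, flatWeight r z i ^ 2 ∂(Measure.pi fun _ : Fin N => μ.prod ν)
      ≤ 192 / (1 + r * N * (μ.real {i} + ν.real {i})) := by
  set x := r * N * (μ.real {i} + ν.real {i})
  have hx0 : 0 ≤ x := by positivity
  calc _ ≤ x * (192 / (1 + x) ^ 2) := by
        gcongr
        exact integral_flatWeight_sq_le N hr hr1 i
    _ ≤ (1 + x) * (192 / (1 + x) ^ 2) := by gcongr; linarith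
    _ = 192 / (1 + x) := by field_simp

end Flattening

section GoodWeights

variable {α : Type*} [Fintype α] [MeasurableSpace α] (μ ν : Measure α)

/-- The squared `ℓ²` distance of two laws, with the weight `w i` at the point `i`. -/
noncomputable def weightedDistSq (w : α → ℝ) : ℝ :=
  ∑ i, w i * (μ.real {i} - ν.real {i}) ^ 2

/-- The squared `ℓ²` distance of two laws after ideal flattening with `M` samples, that is, with
every count replaced by its mean. -/
noncomputable def flatDistSq (M : ℝ) : ℝ :=
  weightedDistSq μ ν fun i => 1 / (1 + M * (μ.real {i} + ν.real {i}))

/-- The quantity paired with `weightedDistSq μ ν w` when the Cauchy–Schwarz inequality is applied to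
`flatDistSq μ ν M`. -/
noncomputable def dualDistSq (M : ℝ) (w : α → ℝ) : ℝ :=
  ∑ i, ((μ.real {i} - ν.real {i}) / (1 + M * (μ.real {i} + ν.real {i}))) ^ 2 / w i

/-- The part of the variance of the score `w i * freqDiff z i` that is due to the difference of the
two laws. -/
noncomputable def signalVar (w : α → ℝ) : ℝ :=
  ∑ i, (μ.real {i} + ν.real {i}) * w i ^ 2 * (μ.real {i} - ν.real {i}) ^ 2

/-- `N` times the part of the variance of the score `w i * freqDiff z i` that is due to `freqDiff`
being an estimate from `N` pairs. -/
noncomputable def noiseVar (w : α → ℝ) : ℝ :=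
  ∑ i, (μ.real {i} + ν.real {i}) ^ 2 * w i ^ 2

/-- Weights that are as good as the ideal flattening weights up to constant factors: they keep the
squared distance and have a small variance. Each constant is `180` times the one that holds in
expectation. -/
structure GoodWeights (M : ℝ) (w : α → ℝ) : Prop where
  flatDistSq_le : flatDistSq μ ν M ≤ 180 * weightedDistSq μ ν w
  signalVar_le : M * signalVar μ ν w ≤ 180 * (192 * flatDistSq μ ν M)
  noiseVar_le : M * noiseVar μ ν w ≤ 180 * 384

theorem signalVar_nonneg (w : α → ℝ) : 0 ≤ signalVar μ ν w :=
  Finset.sum_nonneg fun _ _ => by positivity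

theorem noiseVar_nonneg (w : α → ℝ) : 0 ≤ noiseVar μ ν w :=
  Finset.sum_nonneg fun _ _ => by positivity

theorem dualDistSq_nonneg (M : ℝ) {w : α → ℝ} (hw : ∀ i, 0 < w i) : 0 ≤ dualDistSq μ ν M w :=
  Finset.sum_nonneg fun i _ => div_nonneg (sq_nonneg _) (hw i).le

theorem sq_flatDistSq_le {M : ℝ} (hM : 0 ≤ M) {w : α → ℝ} (hw : ∀ i, 0 < w i) :
    flatDistSq μ ν M ^ 2 ≤ weightedDistSq μ ν w * dualDistSq μ ν M w := by
  refine Finset.sum_sq_le_sum_mul_sum_of_sq_le_mul _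
    (fun i _ => mul_nonneg (hw i).le (sq_nonneg _))
    (fun i _ => div_nonneg (sq_nonneg _) (hw i).le) fun i _ => le_of_eq ?_
  have : 0 < 1 + M * (μ.real {i} + ν.real {i}) := by positivity
  have := (hw i).ne'
  field_simp

variable {μ ν}

theorem goodWeights_of_dualDistSq_le {M : ℝ} (hM : 0 ≤ M) (hS : 0 < flatDistSq μ ν M) {w : α → ℝ}
    (hw : ∀ i, 0 < w i) (hdual : dualDistSq μ ν M w ≤ 180 * flatDistSq μ ν M)
    (hsignal : M * signalVar μ ν w ≤ 180 * (192 * flatDistSq μ ν M))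
    (hnoise : M * noiseVar μ ν w ≤ 180 * 384) : GoodWeights μ ν M w where
  flatDistSq_le := by
    have hw0 : 0 ≤ weightedDistSq μ ν w :=
      Finset.sum_nonneg fun i _ => mul_nonneg (hw i).le (sq_nonneg _)
    refine le_of_mul_le_mul_right ?_ hS
    calc flatDistSq μ ν M * flatDistSq μ ν M = flatDistSq μ ν M ^ 2 := (sq _).symm
      _ ≤ weightedDistSq μ ν w * dualDistSq μ ν M w := sq_flatDistSq_le μ ν hM hw
      _ ≤ weightedDistSq μ ν w * (180 * flatDistSq μ ν M) := by gcongr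
      _ = _ := by ring
  signalVar_le := hsignal
  noiseVar_le := hnoise

variable [MeasurableSingletonClass α] [IsProbabilityMeasure μ] [IsProbabilityMeasure ν]

theorem sum_measureReal_singleton_add : ∑ i, (μ.real {i} + ν.real {i}) = 2 := by
  rw [Finset.sum_add_distrib]
  norm_num

theorem sq_sum_abs_sub_le {M : ℝ} (hM : 0 ≤ M) :
    (∑ i, |μ.real {i} - ν.real {i}|) ^ 2 ≤ flatDistSq μ ν M * (Fintype.card α + 2 * M) := by
  have hsum : ∑ i, (1 + M * (μ.real {i} + ν.real {i})) = Fintype.card α + 2 * M := by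
    rw [Finset.sum_add_distrib, ← Finset.mul_sum, sum_measureReal_singleton_add]
    simp [mul_comm]
  rw [← hsum]
  refine Finset.sum_sq_le_sum_mul_sum_of_sq_le_mul _ (fun i _ => by positivity)
    (fun i _ => by positivity) fun i _ => le_of_eq ?_
  have : 0 < 1 + M * (μ.real {i} + ν.real {i}) := by positivity
  rw [sq_abs]
  field_simp

theorem integral_dualDistSq {N : ℕ} {r : ℝ} (hr : 0 ≤ r) :
    ∫ z, dualDistSq μ ν (r * N) (flatWeight r z) ∂(Measure.pi fun _ : Fin N => μ.prod ν)
      = flatDistSq μ ν (r * N) := by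
  simp only [dualDistSq, flatDistSq, weightedDistSq]
  rw [integral_finsetSum _ fun _ _ => .of_finite]
  refine Finset.sum_congr rfl fun i _ => ?_
  have : 0 < 1 + r * N * (μ.real {i} + ν.real {i}) := by positivity
  simp only [flatWeight, div_div_eq_mul_div, div_one]
  rw [integral_const_mul, integral_add .of_finite .of_finite, integral_const_mul,
    integral_pairCount, ← mul_assoc]
  simp only [integral_const, probReal_univ, smul_eq_mul, one_mul]
  field_simp

theorem mul_integral_signalVar_le (N : ℕ) {r : ℝ} (hr : 0 < r) (hr1 : r ≤ 1) :
    r * N * ∫ z, signalVar μ ν (flatWeight r z) ∂(Measure.pi fun _ : Fin N => μ.prod ν)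
      ≤ 192 * flatDistSq μ ν (r * N) := by
  simp only [signalVar, flatDistSq, weightedDistSq]
  rw [integral_finsetSum _ fun _ _ => .of_finite, Finset.mul_sum, Finset.mul_sum]
  refine Finset.sum_le_sum fun i _ => ?_
  rw [integral_mul_const, integral_const_mul, ← mul_assoc, ← mul_assoc, ← mul_assoc, mul_one_div]
  exact mul_le_mul_of_nonneg_right (mul_integral_flatWeight_sq_le N hr hr1 i) (sq_nonneg _)

theorem mul_integral_noiseVar_le (N : ℕ) {r : ℝ} (hr : 0 < r) (hr1 : r ≤ 1) :
    r * N * ∫ z, noiseVar μ ν (flatWeight r z) ∂(Measure.pi fun _ : Fin N => μ.prod ν) ≤ 384 := by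
  simp only [noiseVar]
  rw [integral_finsetSum _ fun _ _ => .of_finite, Finset.mul_sum]
  calc _ ≤ ∑ i, (μ.real {i} + ν.real {i}) * 192 := Finset.sum_le_sum fun i _ => by
        rw [integral_const_mul]
        have hle : 192 / (1 + r * N * (μ.real {i} + ν.real {i})) ≤ 192 :=
          div_le_self (by norm_num) (le_add_of_nonneg_right (by positivity))
        calc _ = (μ.real {i} + ν.real {i}) * (r * N * (μ.real {i} + ν.real {i})
              * ∫ z, flatWeight r z i ^ 2 ∂(Measure.pi fun _ : Fin N => μ.prod ν)) := by ring
          _ ≤ _ := by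
              gcongr
              exact (mul_integral_flatWeight_sq_le N hr hr1 i).trans hle
    _ = 384 := by
        rw [← Finset.sum_mul, sum_measureReal_singleton_add]
        norm_num

theorem measureReal_not_goodWeights_le {N : ℕ} {r : ℝ} (hr : 0 < r) (hr1 : r ≤ 1)
    (hS : 0 < flatDistSq μ ν (r * N)) :
    (Measure.pi fun _ : Fin N => μ.prod ν).real {z | ¬ GoodWeights μ ν (r * N) (flatWeight r z)}
      ≤ 1 / 60 := by
  set S := flatDistSq μ ν (r * N)
  set π := Measure.pi fun _ : Fin N => μ.prod ν
  have hdual : π.real {z | 180 * S ≤ dualDistSq μ ν (r * N) (flatWeight r z)} ≤ 1 / 180 :=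
    measureReal_le_of_integral_le (fun z => dualDistSq_nonneg μ ν _ (flatWeight_pos hr.le z))
      .of_finite (by positivity) (by rw [integral_dualDistSq hr.le]; linarith)
  have hsignal : π.real {z | 180 * (192 * S) ≤ r * N * signalVar μ ν (flatWeight r z)}
      ≤ 1 / 180 :=
    measureReal_le_of_integral_le
      (fun z => mul_nonneg (by positivity) (signalVar_nonneg μ ν _)) .of_finite (by positivity)
      (by rw [integral_const_mul]; linarith [mul_integral_signalVar_le (μ := μ) (ν := ν) N hr hr1])
  have hnoise : π.real {z | 180 * 384 ≤ r * N * noiseVar μ ν (flatWeight r z)} ≤ 1 / 180 :=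
    measureReal_le_of_integral_le
      (fun z => mul_nonneg (by positivity) (noiseVar_nonneg μ ν _)) .of_finite (by positivity)
      (by rw [integral_const_mul]; linarith [mul_integral_noiseVar_le (μ := μ) (ν := ν) N hr hr1])
  refine (measureReal_mono fun z hz => ?_).trans ((measureReal_union_le _ _).trans
    ((add_le_add (measureReal_union_le _ _) le_rfl).trans
      ((add_le_add (add_le_add hdual hsignal) hnoise).trans (by norm_num))))
  contrapose! hz
  simp only [Set.mem_union, Set.mem_ofPred_eq, not_or, not_le, not_not] at hz ⊢
  exact goodWeights_of_dualDistSq_le (by positivity) hS (flatWeight_pos hr.le z) hz.1.1.le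
    hz.1.2.le hz.2.le

end GoodWeights

section LearnedScore

variable {α : Type*}

/-- The difference between the frequencies of `i` among the first and among the second coordinates
of a sample of pairs. -/
noncomputable def freqDiff {N : ℕ} (z : Fin N → α × α) (i : α) : ℝ :=
  empMean (fun p => ({i} : Set α).indicator 1 p.1 - ({i} : Set α).indicator 1 p.2) z

/-- The threshold for the score `f` learned from a sample of pairs: the midpoint of the empirical
means of `f` over the two coordinates. -/
noncomputable def empMidpoint {N : ℕ} (f : α → ℝ) (z : Fin N → α × α) : ℝ :=
  empMean (fun p => f p.1 / 2 + f p.2 / 2) z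

theorem empMean_sub_eq_sum_mul_freqDiff [Fintype α] {N : ℕ} (g : α → ℝ) (z : Fin N → α × α) :
    empMean (fun p => g p.1 - g p.2) z = ∑ i, g i * freqDiff z i := by
  classical
  simp only [freqDiff, empMean, mul_div_assoc', ← Finset.sum_div, Finset.mul_sum]
  rw [Finset.sum_comm]
  simp [Set.indicator_apply, mul_sub, Finset.sum_sub_distrib]

variable [MeasurableSpace α] (μ ν : Measure α)

/-- The gap between the means of the score `f` under the two laws. -/
noncomputable def scoreGap (f : α → ℝ) : ℝ :=
  ∫ a, f a ∂μ - ∫ a, f a ∂ν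

/-- The sum of the second moments of the score `f` under the two laws. -/
noncomputable def scoreSq (f : α → ℝ) : ℝ :=
  ∫ a, f a ^ 2 ∂μ + ∫ a, f a ^ 2 ∂ν

/-- A score whose gap is large compared to the standard deviation of its empirical mean over
`m` samples. -/
structure Informative (m : ℕ) (f : α → ℝ) : Prop where
  scoreGap_pos : 0 < scoreGap μ ν f
  scoreSq_le : 512 * scoreSq μ ν f ≤ m * scoreGap μ ν f ^ 2

/-- Comparing the empirical mean of `f` over `m` samples with `t` recognises each of the two laws
with error probability at most `1 / 16`. -/
structure Separates (m : ℕ) (f : α → ℝ) (t : ℝ) : Prop where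
  left : (Measure.pi fun _ : Fin m => μ).real {x | ¬ t < empMean f x} ≤ 1 / 16
  right : (Measure.pi fun _ : Fin m => ν).real {x | t < empMean f x} ≤ 1 / 16

variable {μ ν}

theorem informative_of_abs_scoreGap_sub_lt {m : ℕ} {f : α → ℝ} {S : ℝ}
    (hgap : |scoreGap μ ν f - S| < S / 2) (hsq : 2048 * scoreSq μ ν f ≤ m * S ^ 2) :
    Informative μ ν m f := by
  obtain ⟨h₁, -⟩ := abs_lt.1 hgap
  have hS : 0 < S := by linarith [(abs_nonneg _).trans_lt hgap]
  refine ⟨by linarith, ?_⟩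
  calc 512 * scoreSq μ ν f ≤ m * (S / 2) ^ 2 := by linarith
    _ ≤ m * scoreGap μ ν f ^ 2 := by gcongr; linarith

theorem variance_add_prod_le [IsProbabilityMeasure μ] [IsProbabilityMeasure ν] {f g : α → ℝ}
    (hf : MemLp f 2 μ) (hg : MemLp g 2 ν) :
    Var[fun p => f p.1 + g p.2; μ.prod ν] ≤ ∫ a, f a ^ 2 ∂μ + ∫ a, g a ^ 2 ∂ν := by
  rw [variance_add_prod hf hg]
  exact add_le_add (variance_le_integral_sq hf.aestronglyMeasurable)
    (variance_le_integral_sq hg.aestronglyMeasurable)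

theorem variance_sub_prod_le [IsProbabilityMeasure μ] [IsProbabilityMeasure ν] {f g : α → ℝ}
    (hf : MemLp f 2 μ) (hg : MemLp g 2 ν) :
    Var[fun p => f p.1 - g p.2; μ.prod ν] ≤ ∫ a, f a ^ 2 ∂μ + ∫ a, g a ^ 2 ∂ν := by
  simpa only [sub_eq_add_neg, Pi.neg_apply, neg_sq] using variance_add_prod_le hf hg.neg

theorem integral_add_prod [IsProbabilityMeasure μ] [IsProbabilityMeasure ν] {f g : α → ℝ}
    (hf : Integrable f μ) (hg : Integrable g ν) :
    ∫ p, (f p.1 + g p.2) ∂μ.prod ν = ∫ a, f a ∂μ + ∫ a, g a ∂ν := by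
  rw [integral_add (hf.comp_fst ν) (hg.comp_snd μ), integral_fun_fst, integral_fun_snd]
  simp

theorem integral_sub_prod [IsProbabilityMeasure μ] [IsProbabilityMeasure ν] {f g : α → ℝ}
    (hf : Integrable f μ) (hg : Integrable g ν) :
    ∫ p, (f p.1 - g p.2) ∂μ.prod ν = ∫ a, f a ∂μ - ∫ a, g a ∂ν := by
  simpa only [sub_eq_add_neg, Pi.neg_apply, integral_neg] using integral_add_prod hf hg.neg

theorem Informative.measureReal_deviation_le {ρ : Measure α} [IsProbabilityMeasure ρ]
    {m : ℕ} (hm : m ≠ 0) {f : α → ℝ} (h : Informative μ ν m f) (hf : MemLp f 2 ρ)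
    (hρ : ∫ a, f a ^ 2 ∂ρ ≤ scoreSq μ ν f) :
    (Measure.pi fun _ : Fin m => ρ).real
      {x | scoreGap μ ν f / 4 ≤ |empMean f x - ∫ a, f a ∂ρ|} ≤ 1 / 16 := by
  obtain ⟨hgap, hsq⟩ := h
  have : (0 : ℝ) < m := by positivity
  have hpos : 0 < m * scoreGap μ ν f ^ 2 := by positivity
  refine (measureReal_le_abs_empMean_sub_le hm hf (by positivity)).trans ?_
  rw [div_le_iff₀ (by positivity)]
  linarith [variance_le_integral_sq hf.aestronglyMeasurable]

theorem Informative.separates {m : ℕ} (hm : m ≠ 0) [IsProbabilityMeasure μ]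
    [IsProbabilityMeasure ν] {f : α → ℝ} (h : Informative μ ν m f) (hfμ : MemLp f 2 μ)
    (hfν : MemLp f 2 ν) {t : ℝ}
    (ht : |t - (∫ a, f a ∂μ + ∫ a, f a ∂ν) / 2| < scoreGap μ ν f / 4) :
    Separates μ ν m f t := by
  have hgap : scoreGap μ ν f = ∫ a, f a ∂μ - ∫ a, f a ∂ν := rfl
  obtain ⟨ht₁, ht₂⟩ := abs_lt.1 ht
  constructor
  · refine (measureReal_mono fun x hx => ?_).trans (h.measureReal_deviation_le hm hfμ
      (le_add_of_nonneg_right (integral_nonneg fun _ => sq_nonneg _)))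
    rw [Set.mem_ofPred_eq, not_lt] at hx
    exact (by linarith : scoreGap μ ν f / 4 ≤ -(empMean f x - ∫ a, f a ∂μ)).trans (neg_le_abs _)
  · refine (measureReal_mono fun x hx => ?_).trans (h.measureReal_deviation_le hm hfν
      (le_add_of_nonneg_left (integral_nonneg fun _ => sq_nonneg _)))
    rw [Set.mem_ofPred_eq] at hx
    exact (by linarith : scoreGap μ ν f / 4 ≤ empMean f x - ∫ a, f a ∂ν).trans (le_abs_self _)

theorem Informative.measureReal_not_separates_le [IsProbabilityMeasure μ]
    [IsProbabilityMeasure ν] {m N : ℕ} (hm : m ≠ 0) (hmN : m ≤ N) {f : α → ℝ}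
    (h : Informative μ ν m f) (hfμ : MemLp f 2 μ) (hfν : MemLp f 2 ν) :
    (Measure.pi fun _ : Fin N => μ.prod ν).real {z | ¬ Separates μ ν m f (empMidpoint f z)}
      ≤ 1 / 64 := by
  obtain ⟨hgap, hsq⟩ := id h
  have hf₁ : MemLp (fun a => f a / 2) 2 μ := by simpa only [div_eq_mul_inv] using hfμ.mul_const _
  have hf₂ : MemLp (fun a => f a / 2) 2 ν := by simpa only [div_eq_mul_inv] using hfν.mul_const _
  have hmean : ∫ p : α × α, (f p.1 / 2 + f p.2 / 2) ∂μ.prod ν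
      = (∫ a, f a ∂μ + ∫ a, f a ∂ν) / 2 := by
    rw [integral_add_prod (hf₁.integrable one_le_two) (hf₂.integrable one_le_two), integral_div,
      integral_div, add_div]
  have hvar : Var[fun p : α × α => f p.1 / 2 + f p.2 / 2; μ.prod ν] ≤ scoreSq μ ν f / 4 := by
    refine (variance_add_prod_le hf₁ hf₂).trans (le_of_eq ?_)
    simp only [div_pow, integral_div, scoreSq]
    ring
  have hdev := measureReal_le_abs_empMean_sub_le (N := N) (by omega)
    ((hf₁.comp_fst ν).add (hf₂.comp_snd μ)) (by positivity : 0 < scoreGap μ ν f / 4)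
  refine (measureReal_mono fun z hz => ?_).trans (hdev.trans ?_)
  · contrapose! hz
    simp only [Set.mem_ofPred_eq, not_le, not_not] at hz ⊢
    exact h.separates hm hfμ hfν (hmean ▸ hz)
  · have hN0 : (0 : ℝ) < N := by exact_mod_cast (by omega : 0 < N)
    have hmono : m * scoreGap μ ν f ^ 2 ≤ N * scoreGap μ ν f ^ 2 := by gcongr
    rw [div_le_iff₀ (by positivity)]
    have hpos : 0 < N * scoreGap μ ν f ^ 2 := by positivity
    exact hvar.trans (by linarith)

variable [MeasurableSingletonClass α] [IsProbabilityMeasure μ] [IsProbabilityMeasure ν]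

theorem integral_sq_freqDiff_le {N : ℕ} (hN : N ≠ 0) (i : α) :
    ∫ z, freqDiff z i ^ 2 ∂(Measure.pi fun _ : Fin N => μ.prod ν)
      ≤ (μ.real {i} - ν.real {i}) ^ 2 + (μ.real {i} + ν.real {i}) / N := by
  have hi (ρ : Measure α) [IsProbabilityMeasure ρ] :
      MemLp (({i} : Set α).indicator (1 : α → ℝ)) 2 ρ :=
    memLp_indicator_const 2 (measurableSet_singleton i) 1 (.inr (measure_ne_top _ _))
  have hsq (ρ : Measure α) [IsProbabilityMeasure ρ] :
      ∫ a, ({i} : Set α).indicator (1 : α → ℝ) a ^ 2 ∂ρ = ρ.real {i} := by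
    rw [← integral_indicator_one (measurableSet_singleton i)]
    congr with a
    by_cases h : a = i <;> simp [h]
  have hp : MemLp (fun p : α × α => ({i} : Set α).indicator (1 : α → ℝ) p.1
      - ({i} : Set α).indicator 1 p.2) 2 (μ.prod ν) := ((hi μ).comp_fst ν).sub ((hi ν).comp_snd μ)
  have hmean : ∫ z, freqDiff z i ∂(Measure.pi fun _ : Fin N => μ.prod ν)
      = μ.real {i} - ν.real {i} := by
    simp only [freqDiff]
    rw [integral_empMean hN (hp.integrable one_le_two), integral_sub_prod
      ((hi μ).integrable one_le_two) ((hi ν).integrable one_le_two),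
      integral_indicator_one (measurableSet_singleton i),
      integral_indicator_one (measurableSet_singleton i)]
  have hvar : Var[fun z => freqDiff z i; Measure.pi fun _ : Fin N => μ.prod ν]
      ≤ (μ.real {i} + ν.real {i}) / N := by
    refine (variance_empMean N hp).trans_le ?_
    have := variance_sub_prod_le (hi μ) (hi ν)
    rw [hsq, hsq] at this
    gcongr
  have hsub : Var[fun z => freqDiff z i; Measure.pi fun _ : Fin N => μ.prod ν]
      = ∫ z, freqDiff z i ^ 2 ∂(Measure.pi fun _ : Fin N => μ.prod ν)
        - (∫ z, freqDiff z i ∂(Measure.pi fun _ : Fin N => μ.prod ν)) ^ 2 :=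
    variance_eq_sub (memLp_empMean N hp)
  rw [hmean] at hsub
  linarith

variable [Fintype α]

theorem scoreGap_eq_sum (f : α → ℝ) :
    scoreGap μ ν f = ∑ i, (μ.real {i} - ν.real {i}) * f i := by
  simp only [scoreGap, integral_fintype .of_finite, smul_eq_mul, sub_mul, Finset.sum_sub_distrib]

theorem scoreSq_eq_sum (f : α → ℝ) :
    scoreSq μ ν f = ∑ i, (μ.real {i} + ν.real {i}) * f i ^ 2 := by
  simp only [scoreSq, integral_fintype .of_finite, smul_eq_mul, add_mul, Finset.sum_add_distrib]

theorem integral_scoreSq_le {N : ℕ} (hN : N ≠ 0) (w : α → ℝ) :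
    ∫ z, scoreSq μ ν (fun i => w i * freqDiff z i) ∂(Measure.pi fun _ : Fin N => μ.prod ν)
      ≤ signalVar μ ν w + noiseVar μ ν w / N := by
  simp only [scoreSq_eq_sum, signalVar, noiseVar, mul_pow, ← mul_assoc]
  rw [integral_finsetSum _ fun _ _ => .of_finite, Finset.sum_div, ← Finset.sum_add_distrib]
  refine Finset.sum_le_sum fun i _ => ?_
  rw [integral_const_mul]
  calc _ ≤ (μ.real {i} + ν.real {i}) * w i ^ 2
        * ((μ.real {i} - ν.real {i}) ^ 2 + (μ.real {i} + ν.real {i}) / N) := by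
        gcongr
        exact integral_sq_freqDiff_le hN i
    _ = _ := by ring

theorem measureReal_le_abs_scoreGap_sub_le {N : ℕ} (hN : N ≠ 0) (w : α → ℝ) {c : ℝ}
    (hc : 0 < c) :
    (Measure.pi fun _ : Fin N => μ.prod ν).real
        {z | c ≤ |scoreGap μ ν (fun i => w i * freqDiff z i) - weightedDistSq μ ν w|}
      ≤ signalVar μ ν w / (N * c ^ 2) := by
  let g : α → ℝ := fun i => w i * (μ.real {i} - ν.real {i})
  have hgap (z : Fin N → α × α) : scoreGap μ ν (fun i => w i * freqDiff z i)
      = empMean (fun p => g p.1 - g p.2) z := by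
    rw [scoreGap_eq_sum, empMean_sub_eq_sum_mul_freqDiff]
    exact Finset.sum_congr rfl fun i _ => by ring
  have hmean : ∫ p : α × α, (g p.1 - g p.2) ∂μ.prod ν = weightedDistSq μ ν w := by
    rw [integral_sub_prod .of_finite .of_finite]
    exact (scoreGap_eq_sum g).trans (Finset.sum_congr rfl fun i _ => by ring)
  have hvar : Var[fun p : α × α => g p.1 - g p.2; μ.prod ν] ≤ signalVar μ ν w :=
    (variance_sub_prod_le .of_discrete .of_discrete).trans_eq
      ((scoreSq_eq_sum g).trans (Finset.sum_congr rfl fun i _ => by ring))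
  simp only [hgap, ← hmean]
  exact (measureReal_le_abs_empMean_sub_le hN .of_discrete hc).trans (by gcongr)

theorem measureReal_not_informative_le {N m : ℕ} (hm : m ≠ 0) (hmN : m ≤ N) {w : α → ℝ}
    (hS : 0 < weightedDistSq μ ν w)
    (hsignal : signalVar μ ν w ≤ 2 / 10 ^ 6 * (m * weightedDistSq μ ν w ^ 2))
    (hnoise : noiseVar μ ν w / N ≤ 3 / 10 ^ 6 * (m * weightedDistSq μ ν w ^ 2)) :
    (Measure.pi fun _ : Fin N => μ.prod ν).real
      {z | ¬ Informative μ ν m fun i => w i * freqDiff z i} ≤ 1 / 60 := by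
  set S := weightedDistSq μ ν w
  have hN0 : (0 : ℝ) < N := by exact_mod_cast (by omega : 0 < N)
  have hmS : 0 < m * S ^ 2 := by positivity
  have hgap : (Measure.pi fun _ : Fin N => μ.prod ν).real
      {z | S / 2 ≤ |scoreGap μ ν (fun i => w i * freqDiff z i) - S|} ≤ 1 / 1000 := by
    refine (measureReal_le_abs_scoreGap_sub_le (by omega) w (by positivity)).trans ?_
    have hmono : m * S ^ 2 ≤ N * S ^ 2 := by gcongr
    rw [div_le_iff₀ (by positivity)]
    linarith
  have hsq : (Measure.pi fun _ : Fin N => μ.prod ν).real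
      {z | m * S ^ 2 ≤ 2048 * scoreSq μ ν fun i => w i * freqDiff z i} ≤ 11 / 1000 := by
    refine measureReal_le_of_integral_le (fun z => ?_) .of_finite hmS ?_
    · rw [scoreSq_eq_sum]
      exact mul_nonneg (by norm_num) (Finset.sum_nonneg fun i _ => by positivity)
    · rw [integral_const_mul]
      linarith [integral_scoreSq_le (μ := μ) (ν := ν) (N := N) (by omega) w]
  refine (measureReal_mono fun z hz => ?_).trans ((measureReal_union_le _ _).trans
    ((add_le_add hgap hsq).trans (by norm_num)))
  contrapose! hz
  simp only [Set.mem_union, Set.mem_ofPred_eq, not_or, not_le, not_not] at hz ⊢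
  exact informative_of_abs_scoreGap_sub_lt hz.1 hz.2.le

end LearnedScore

section Training

variable {α : Type*}

/-- The score learned from the first two of three samples of pairs: the first sample gives the
weights, the second one the differences of the frequencies. -/
noncomputable def learnedScore {N : ℕ} (r : ℝ) (w : Fin 3 → Fin N → α × α) (i : α) : ℝ :=
  flatWeight r (w 0) i * freqDiff (w 1) i

/-- The threshold for the learned score, computed from the third sample of pairs. -/
noncomputable def learnedThreshold {N : ℕ} (r : ℝ) (w : Fin 3 → Fin N → α × α) : ℝ :=
  empMidpoint (learnedScore r w) (w 2)

variable [Fintype α] [MeasurableSpace α] {μ ν : Measure α} {M : ℝ} {w : α → ℝ}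

theorem GoodWeights.sq_flatDistSq_le (hw : GoodWeights μ ν M w) (hS : 0 < flatDistSq μ ν M) :
    flatDistSq μ ν M ^ 2 ≤ 32400 * weightedDistSq μ ν w ^ 2 := by
  calc flatDistSq μ ν M ^ 2 ≤ (180 * weightedDistSq μ ν w) ^ 2 :=
        pow_le_pow_left₀ hS.le hw.flatDistSq_le 2
    _ = 32400 * weightedDistSq μ ν w ^ 2 := by ring

theorem GoodWeights.signalVar_le_mul_sq (hw : GoodWeights μ ν M w) (hM : 0 < M)
    (hS : 0 < flatDistSq μ ν M) {m : ℕ} (h : 10 ^ 15 ≤ m * M * flatDistSq μ ν M) :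
    signalVar μ ν w ≤ 2 / 10 ^ 6 * (m * weightedDistSq μ ν w ^ 2) := by
  have hV : 10 ^ 15 * signalVar μ ν w ≤ 34560 * (m * flatDistSq μ ν M ^ 2) := by
    refine le_of_mul_le_mul_left ?_ hM
    calc M * (10 ^ 15 * signalVar μ ν w) = 10 ^ 15 * (M * signalVar μ ν w) := by ring
      _ ≤ 10 ^ 15 * (180 * (192 * flatDistSq μ ν M)) :=
          mul_le_mul_of_nonneg_left hw.signalVar_le (by norm_num)
      _ ≤ m * M * flatDistSq μ ν M * (180 * (192 * flatDistSq μ ν M)) := by gcongr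
      _ = M * (34560 * (m * flatDistSq μ ν M ^ 2)) := by ring
  have hS2 := mul_le_mul_of_nonneg_left (hw.sq_flatDistSq_le hS) m.cast_nonneg
  have := mul_nonneg m.cast_nonneg (sq_nonneg (weightedDistSq μ ν w))
  linarith

theorem GoodWeights.noiseVar_div_le_mul_sq (hw : GoodWeights μ ν M w) (hM : 0 < M)
    (hS : 0 < flatDistSq μ ν M) {m N : ℕ} (hN : N ≠ 0)
    (h : 10 ^ 15 ≤ m * N * M * flatDistSq μ ν M ^ 2) :
    noiseVar μ ν w / N ≤ 3 / 10 ^ 6 * (m * weightedDistSq μ ν w ^ 2) := by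
  have hN0 : (0 : ℝ) < N := by positivity
  have hV : 10 ^ 15 * (noiseVar μ ν w / N) ≤ 69120 * (m * flatDistSq μ ν M ^ 2) := by
    rw [mul_div_assoc', div_le_iff₀ hN0]
    refine le_of_mul_le_mul_left ?_ hM
    calc M * (10 ^ 15 * noiseVar μ ν w) = 10 ^ 15 * (M * noiseVar μ ν w) := by ring
      _ ≤ 10 ^ 15 * (180 * 384) :=
          mul_le_mul_of_nonneg_left hw.noiseVar_le (by norm_num)
      _ ≤ m * N * M * flatDistSq μ ν M ^ 2 * (180 * 384) := by gcongr
      _ = M * (69120 * (m * flatDistSq μ ν M ^ 2) * N) := by ring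
  have hS2 := mul_le_mul_of_nonneg_left (hw.sq_flatDistSq_le hS) m.cast_nonneg
  have := mul_nonneg m.cast_nonneg (sq_nonneg (weightedDistSq μ ν w))
  linarith

variable [MeasurableSingletonClass α] [IsProbabilityMeasure μ] [IsProbabilityMeasure ν]

theorem GoodWeights.measureReal_not_separates_le (hw : GoodWeights μ ν M w) (hM : 0 < M)
    (hS : 0 < flatDistSq μ ν M) {m N : ℕ} (hm : m ≠ 0) (hmN : m ≤ N)
    (hsignal : 10 ^ 15 ≤ m * M * flatDistSq μ ν M)
    (hnoise : 10 ^ 15 ≤ m * N * M * flatDistSq μ ν M ^ 2) :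
    ((Measure.pi fun _ : Fin N => μ.prod ν).prod (Measure.pi fun _ : Fin N => μ.prod ν)).real
        {z | ¬ Separates μ ν m (fun i => w i * freqDiff z.1 i)
          (empMidpoint (fun i => w i * freqDiff z.1 i) z.2)} ≤ 1 / 60 + 1 / 64 := by
  have hpos : 0 < weightedDistSq μ ν w := by linarith [hw.flatDistSq_le]
  exact measureReal_prod_le
    (G := {z | Informative μ ν m fun i => w i * freqDiff z i}) .of_discrete .of_discrete
    (by norm_num) (measureReal_not_informative_le hm hmN hpos (hw.signalVar_le_mul_sq hM hS hsignal)
      (hw.noiseVar_div_le_mul_sq hM hS (by omega) hnoise))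
    fun _ hz => hz.measureReal_not_separates_le hm hmN .of_discrete .of_discrete

theorem measureReal_not_separates_learned_le {m N : ℕ} (hm : m ≠ 0) (hmN : m ≤ N) {r : ℝ}
    (hr : 0 < r) (hr1 : r ≤ 1) (hS : 0 < flatDistSq μ ν (r * N))
    (hsignal : 10 ^ 15 ≤ m * (r * N) * flatDistSq μ ν (r * N))
    (hnoise : 10 ^ 15 ≤ m * N * (r * N) * flatDistSq μ ν (r * N) ^ 2) :
    (Measure.pi fun _ : Fin 3 => Measure.pi fun _ : Fin N => μ.prod ν).real
      {w | ¬ Separates μ ν m (learnedScore r w) (learnedThreshold r w)} ≤ 1 / 20 := by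
  set π : Measure (Fin N → α × α) := Measure.pi fun _ : Fin N => μ.prod ν
  have hM : 0 < r * N := mul_pos hr (by exact_mod_cast (by omega : 0 < N))
  have htriple : MeasurePreserving (fun w : Fin 3 → Fin N → α × α => (w 0, w 1, w 2))
      (Measure.pi fun _ => π) (π.prod (π.prod π)) :=
    ((MeasurePreserving.id π).prod (measurePreserving_finTwoArrow π)).comp
      (measurePreserving_piFinSuccAbove (fun _ : Fin 3 => π) 0)
  let B : Set ((Fin N → α × α) × (Fin N → α × α) × (Fin N → α × α)) :=
    {z | ¬ Separates μ ν m (fun i => flatWeight r z.1 i * freqDiff z.2.1 i)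
      (empMidpoint (fun i => flatWeight r z.1 i * freqDiff z.2.1 i) z.2.2)}
  calc _ = (π.prod (π.prod π)).real B :=
        htriple.measureReal_preimage (s := B) MeasurableSet.of_discrete.nullMeasurableSet
    _ ≤ 1 / 60 + (1 / 60 + 1 / 64) :=
        measureReal_prod_le (G := {z | GoodWeights μ ν (r * N) (flatWeight r z)}) .of_discrete
          .of_discrete (by norm_num) (measureReal_not_goodWeights_le hr hr1 hS)
          fun _ hz => hz.measureReal_not_separates_le hM hS hm hmN hsignal hnoise
    _ ≤ 1 / 20 := by norm_num

end Training

section BlockTest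

variable {α : Type*}

/-- Strict majority vote over `L` blocks of `m` samples on whether the empirical mean of `f`
exceeds `t`. -/
noncomputable def blockTest {L m : ℕ} (f : α → ℝ) (t : ℝ) (z : Fin L → Fin m → α) : Bool :=
  decide (L < 2 * Finset.card {l | t < empMean f (z l)})

variable [Finite α] [MeasurableSpace α] [MeasurableSingletonClass α] {μ ν : Measure α}
  {m : ℕ} {f : α → ℝ} {t : ℝ}

theorem Separates.measureReal_blockTest_ne_true_le [IsProbabilityMeasure μ]
    (h : Separates μ ν m f t) (L : ℕ) :
    (Measure.pi fun _ : Fin L => Measure.pi fun _ : Fin m => μ).real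
      {z | blockTest f t z ≠ true} ≤ (1 / 2) ^ L := by
  refine (measureReal_mono fun z hz => ?_).trans ((measureReal_half_fail_le
    (B := fun x => ¬ t < empMean f x) .of_discrete (by norm_num : (1 : ℝ) ≤ 4)
    (by linarith [h.left]) L).trans_eq (by norm_num))
  have hcard := Finset.card_filter_add_card_filter_not (s := (Finset.univ : Finset (Fin L)))
    fun l => t < empMean f (z l)
  rw [Finset.card_univ, Fintype.card_fin] at hcard
  simp only [Set.mem_ofPred_eq, blockTest, ne_eq, decide_eq_true_eq] at hz ⊢
  omega

theorem Separates.measureReal_blockTest_ne_false_le [IsProbabilityMeasure ν]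
    (h : Separates μ ν m f t) (L : ℕ) :
    (Measure.pi fun _ : Fin L => Measure.pi fun _ : Fin m => ν).real
      {z | blockTest f t z ≠ false} ≤ (1 / 2) ^ L := by
  refine (measureReal_mono fun z hz => ?_).trans ((measureReal_half_fail_le
    (B := fun x => t < empMean f x) .of_discrete (by norm_num : (1 : ℝ) ≤ 4)
    (by linarith [h.right]) L).trans_eq (by norm_num))
  simp only [Set.mem_ofPred_eq, blockTest, ne_eq, decide_eq_false_iff_not, not_not] at hz ⊢
  exact hz.le

end BlockTest

section Rearrangement

variable {α : Type*}

/-- A sample of size `a * b` cut into `a` blocks of size `b`. -/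
def blocks {a b : ℕ} (x : Fin (a * b) → α) (i : Fin a) (j : Fin b) : α :=
  x (finProdFinEquiv (i, j))

/-- Two samples matched up to a sample of pairs, which is cut into three blocks. -/
def pairBlocks {N : ℕ} (x y : Fin (3 * N) → α) : Fin 3 → Fin N → α × α :=
  blocks fun j => (x j, y j)

variable [MeasurableSpace α]

theorem measurePreserving_blocks (μ : Measure α) [IsProbabilityMeasure μ] (a b : ℕ) :
    MeasurePreserving (blocks (α := α) (a := a) (b := b)) (Measure.pi fun _ => μ)
      (Measure.pi fun _ => Measure.pi fun _ => μ) := by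
  have hcurry : MeasurePreserving (MeasurableEquiv.curry (Fin a) (Fin b) α)
      (Measure.pi fun _ => μ) (Measure.pi fun _ => Measure.pi fun _ => μ) := by
    refine ⟨(MeasurableEquiv.curry (Fin a) (Fin b) α).measurable, ?_⟩
    simpa only [Measure.infinitePi_eq_pi] using
      Measure.infinitePi_map_curry fun (_ : Fin a) (_ : Fin b) => μ
  exact hcurry.comp
    (measurePreserving_piCongrLeft (fun _ : Fin (a * b) => μ) finProdFinEquiv).symm

theorem measurePreserving_pairBlocks (μ ν : Measure α) [IsProbabilityMeasure μ]
    [IsProbabilityMeasure ν] (N : ℕ) :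
    MeasurePreserving (fun p : (Fin (3 * N) → α) × (Fin (3 * N) → α) => pairBlocks p.1 p.2)
      ((Measure.pi fun _ => μ).prod (Measure.pi fun _ => ν))
      (Measure.pi fun _ => Measure.pi fun _ => μ.prod ν) :=
  (measurePreserving_blocks (μ.prod ν) 3 N).comp
    (measurePreserving_arrowProdEquivProdArrow α α (Fin (3 * N)) (fun _ => μ) fun _ => ν).symm

end Rearrangement

section Procedure

/-- The procedure that learns a score and a threshold from three blocks of `N` pairs of reference
samples and labels each distribution by `blockTest` on `L` blocks of `m` samples. -/
noncomputable def learnedProcedure (n k N L m : ℕ) (r : ℝ) : ClassificationProcedure n k where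
  s₁ := 3 * N
  s₂ := L * m
  rule x y z := PMF.pure fun i =>
    blockTest (learnedScore r (pairBlocks x y)) (learnedThreshold r (pairBlocks x y))
      (blocks (a := L) (z i))

theorem ClassificationProcedure.le_successProb_of_pure {n k : ℕ} (A : ClassificationProcedure n k)
    (label : (Fin A.s₁ → Fin n) × (Fin A.s₁ → Fin n) × (Fin k → Fin A.s₂ → Fin n) →
      Fin k → Bool)
    (hA : ∀ ω, A.rule ω.1 ω.2.1 ω.2.2 = PMF.pure (label ω)) (P Q : PMF (Fin n))
    (D : Fin k → PMF (Fin n)) {δ : ℝ}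
    (h : (A.sampleLaw P Q D).real {ω | ∃ i, D i ≠ if label ω i = true then P else Q} ≤ δ) :
    ENNReal.ofReal (1 - δ) ≤ A.successProb P Q D := by
  have : IsProbabilityMeasure (A.sampleLaw P Q D) := by
    unfold ClassificationProcedure.sampleLaw
    infer_instance
  have hcompl : {ω | ∃ i, D i ≠ if label ω i = true then P else Q}
      = {ω | ∀ i, D i = if label ω i = true then P else Q}ᶜ := by
    ext ω
    simp
  have hsuccess : A.successProb P Q D
      = A.sampleLaw P Q D {ω | ∀ i, D i = if label ω i = true then P else Q} := by
    unfold ClassificationProcedure.successProb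
    rw [← lintegral_indicator_one .of_discrete]
    refine lintegral_congr fun ω => ?_
    rw [hA, PMF.toMeasure_pure, Measure.dirac_apply' _ .of_discrete]
    rfl
  rw [hcompl, probReal_compl_eq_one_sub .of_discrete] at h
  rw [hsuccess, ← ofReal_measureReal]
  exact ENNReal.ofReal_le_ofReal (by linarith)

variable {n k : ℕ} {P Q : PMF (Fin n)} {D : Fin k → PMF (Fin n)} {m : ℕ}

theorem Separates.measureReal_mislabelled_le {f : Fin n → ℝ} {t : ℝ}
    (h : Separates P.toMeasure Q.toMeasure m f t) (hD : ∀ i, D i = P ∨ D i = Q) (L : ℕ) :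
    (Measure.pi fun i => Measure.pi fun _ : Fin L =>
        Measure.pi fun _ : Fin m => (D i).toMeasure).real
      {v | ∃ i, D i ≠ if blockTest f t (v i) = true then P else Q} ≤ k * (1 / 2) ^ L := by
  have hone (i : Fin k) : (Measure.pi fun i => Measure.pi fun _ : Fin L =>
        Measure.pi fun _ : Fin m => (D i).toMeasure).real
      {v | D i ≠ if blockTest f t (v i) = true then P else Q} ≤ (1 / 2) ^ L := by
    have heval := (measurePreserving_eval (fun i => Measure.pi fun _ : Fin L =>
      Measure.pi fun _ : Fin m => (D i).toMeasure) i).measureReal_preimage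
      (s := {b | D i ≠ if blockTest f t b = true then P else Q})
      MeasurableSet.of_discrete.nullMeasurableSet
    refine heval.trans_le ?_
    rcases hD i with hi | hi <;> rw [hi]
    · refine (measureReal_mono fun b hb => ?_).trans (h.measureReal_blockTest_ne_true_le L)
      exact fun htrue => hb (by simp [htrue])
    · refine (measureReal_mono fun b hb => ?_).trans (h.measureReal_blockTest_ne_false_le L)
      exact fun hfalse => hb (by simp [hfalse])
  rw [Set.ofPred_exists]
  exact (measureReal_iUnion_fintype_le _).trans
    ((Finset.sum_le_sum fun i _ => hone i).trans_eq (by simp))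

theorem measurePreserving_sampleLaw (N L : ℕ) (r : ℝ) :
    MeasurePreserving (fun ω : (Fin (3 * N) → Fin n) × (Fin (3 * N) → Fin n) ×
        (Fin k → Fin (L * m) → Fin n) => (pairBlocks ω.1 ω.2.1, fun i => blocks (ω.2.2 i)))
      ((learnedProcedure n k N L m r).sampleLaw P Q D)
      ((Measure.pi fun _ : Fin 3 => Measure.pi fun _ : Fin N => P.toMeasure.prod Q.toMeasure).prod
        (Measure.pi fun i => Measure.pi fun _ : Fin L =>
          Measure.pi fun _ : Fin m => (D i).toMeasure)) :=
  ((measurePreserving_pairBlocks P.toMeasure Q.toMeasure N).prod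
    (measurePreserving_pi _ _ fun i => measurePreserving_blocks (D i).toMeasure L m)).comp
    (measurePreserving_prodAssoc _ _ _).symm

theorem le_successProb_learnedProcedure {N L : ℕ} {r : ℝ} (hm : m ≠ 0) (hmN : m ≤ N)
    (hr : 0 < r) (hr1 : r ≤ 1) (hL : 18 * (k : ℝ) ≤ 2 ^ L)
    (hS : 0 < flatDistSq P.toMeasure Q.toMeasure (r * N))
    (hsignal : 10 ^ 15 ≤ m * (r * N) * flatDistSq P.toMeasure Q.toMeasure (r * N))
    (hnoise : 10 ^ 15 ≤ m * N * (r * N) * flatDistSq P.toMeasure Q.toMeasure (r * N) ^ 2)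
    (hD : ∀ i, D i = P ∨ D i = Q) :
    8 / 9 ≤ (learnedProcedure n k N L m r).successProb P Q D := by
  let mislabelled : Set ((Fin 3 → Fin N → Fin n × Fin n) × (Fin k → Fin L → Fin m → Fin n)) :=
    {p | ∃ i, D i ≠ if blockTest (learnedScore r p.1) (learnedThreshold r p.1) (p.2 i) = true
      then P else Q}
  have hlabel : (k : ℝ) * (1 / 2) ^ L ≤ 1 / 18 := by
    rw [one_div_pow, mul_one_div, div_le_iff₀ (by positivity)]
    linarith
  have hfail := measureReal_prod_le (B := mislabelled)
    (G := {w | Separates P.toMeasure Q.toMeasure m (learnedScore r w) (learnedThreshold r w)})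
    .of_discrete .of_discrete (by norm_num)
    (measureReal_not_separates_learned_le hm hmN hr hr1 hS hsignal hnoise)
    fun w hw => (Separates.measureReal_mislabelled_le hw hD L).trans hlabel
  refine le_trans ?_ ((learnedProcedure n k N L m r).le_successProb_of_pure _ (fun _ => rfl) P Q D
    (((measurePreserving_sampleLaw N L r).measureReal_preimage (s := mislabelled)
      MeasurableSet.of_discrete.nullMeasurableSet).trans_le hfail))
  rw [← ENNReal.ofReal_toReal (by finiteness : (8 / 9 : ENNReal) ≠ ⊤)]
  exact ENNReal.ofReal_le_ofReal (by norm_num)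

end Procedure

section Scales

/-- The order of the number of samples when `K / ε ^ 4` is at most of order `n`. -/
noncomputable def cbrtScale (n K ε : ℝ) : ℝ :=
  (n ^ 2 * K / ε ^ 4) ^ (1 / 3 : ℝ)

/-- The order of the number of samples when `n` is between `K` and `K / ε ^ 4` up to constants. -/
noncomputable def sqrtScale (n K ε : ℝ) : ℝ :=
  √(n * K) / ε ^ 2

/-- The order of the number of samples when `n` is at most of order `K`. -/
noncomputable def linearScale (K ε : ℝ) : ℝ :=
  K / ε ^ 2

/-- The order of the number of samples in all regimes at once. -/
noncomputable def sampleScale (n K ε : ℝ) : ℝ :=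
  max (cbrtScale n K ε) (max (sqrtScale n K ε) (linearScale K ε))

theorem le_const_mul_of_pow_le {a b c : ℝ} {j : ℕ} (hj : j ≠ 0) (hb : 0 ≤ b) (hc : 1 ≤ c)
    (h : a ^ j ≤ c * b ^ j) : a ≤ c * b := by
  refine le_of_pow_le_pow_left₀ hj (by positivity) (h.trans ?_)
  rw [mul_pow]
  exact mul_le_mul_of_nonneg_right (le_self_pow₀ hc hj) (by positivity)

variable {n c K ε : ℝ}

theorem sqrtScale_nonneg : 0 ≤ sqrtScale n K ε := by
  unfold sqrtScale
  positivity

theorem cbrtScale_nonneg (hK : 0 ≤ K) : 0 ≤ cbrtScale n K ε := by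
  unfold cbrtScale
  positivity

theorem linearScale_nonneg (hK : 0 ≤ K) : 0 ≤ linearScale K ε := by
  unfold linearScale
  positivity

theorem cbrtScale_pow_three (hK : 0 ≤ K) : cbrtScale n K ε ^ 3 = n ^ 2 * K / ε ^ 4 := by
  rw [cbrtScale, ← Real.rpow_mul_natCast (by positivity)]
  norm_num

theorem sqrtScale_sq (hn : 0 ≤ n) (hK : 0 ≤ K) : sqrtScale n K ε ^ 2 = n * (K / ε ^ 4) := by
  rw [sqrtScale, div_pow, Real.sq_sqrt (by positivity)]
  ring

theorem sqrtScale_le_cbrtScale (hn : 0 ≤ n) (hc : 1 ≤ c) (hK : 0 ≤ K) (h : K / ε ^ 4 ≤ c * n) :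
    sqrtScale n K ε ≤ c * cbrtScale n K ε := by
  refine le_const_mul_of_pow_le (j := 6) (by norm_num) (cbrtScale_nonneg hK) hc ?_
  calc sqrtScale n K ε ^ 6 = (sqrtScale n K ε ^ 2) ^ 3 := by ring
    _ = (K / ε ^ 4) * (n ^ 3 * (K / ε ^ 4) ^ 2) := by rw [sqrtScale_sq hn hK]; ring
    _ ≤ (c * n) * (n ^ 3 * (K / ε ^ 4) ^ 2) := by gcongr
    _ = c * (cbrtScale n K ε ^ 3) ^ 2 := by rw [cbrtScale_pow_three hK]; ring
    _ = c * cbrtScale n K ε ^ 6 := by ring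

theorem cbrtScale_le_sqrtScale (hn : 0 ≤ n) (hc : 1 ≤ c) (hK : 0 ≤ K) (h : n ≤ c * (K / ε ^ 4)) :
    cbrtScale n K ε ≤ c * sqrtScale n K ε := by
  refine le_const_mul_of_pow_le (j := 6) (by norm_num) sqrtScale_nonneg hc ?_
  calc cbrtScale n K ε ^ 6 = (cbrtScale n K ε ^ 3) ^ 2 := by ring
    _ = n * (n ^ 3 * (K / ε ^ 4) ^ 2) := by rw [cbrtScale_pow_three hK]; ring
    _ ≤ (c * (K / ε ^ 4)) * (n ^ 3 * (K / ε ^ 4) ^ 2) := by gcongr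
    _ = c * (sqrtScale n K ε ^ 2) ^ 3 := by rw [sqrtScale_sq hn hK]; ring
    _ = c * sqrtScale n K ε ^ 6 := by ring

theorem linearScale_le_sqrtScale (hn : 0 ≤ n) (hc : 1 ≤ c) (hK : 0 ≤ K) (h : K ≤ c * n) :
    linearScale K ε ≤ c * sqrtScale n K ε := by
  refine le_const_mul_of_pow_le (j := 2) (by norm_num) sqrtScale_nonneg hc ?_
  calc linearScale K ε ^ 2 = K * (K / ε ^ 4) := by rw [linearScale]; ring
    _ ≤ (c * n) * (K / ε ^ 4) := by gcongr
    _ = c * sqrtScale n K ε ^ 2 := by rw [sqrtScale_sq hn hK]; ring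

theorem sqrtScale_le_linearScale (hn : 0 ≤ n) (hc : 1 ≤ c) (hK : 0 ≤ K) (h : n ≤ c * K) :
    sqrtScale n K ε ≤ c * linearScale K ε := by
  refine le_const_mul_of_pow_le (j := 2) (by norm_num) (linearScale_nonneg hK) hc ?_
  calc sqrtScale n K ε ^ 2 = n * (K / ε ^ 4) := sqrtScale_sq hn hK
    _ ≤ (c * K) * (K / ε ^ 4) := by gcongr
    _ = c * linearScale K ε ^ 2 := by rw [linearScale]; ring

theorem le_div_pow_four (hK : 0 ≤ K) (hε : 0 < ε) (hε1 : ε ≤ 1) : K ≤ K / ε ^ 4 :=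
  le_div_self hK (by positivity) (pow_le_one₀ hε.le hε1)

theorem sampleScale_le_cbrtScale (hn : 0 ≤ n) (hc : 1 ≤ c) (hK : 0 ≤ K) (hε : 0 < ε)
    (hε1 : ε ≤ 1) (h : K / ε ^ 4 ≤ c * n) : sampleScale n K ε ≤ c ^ 2 * cbrtScale n K ε := by
  have hsqrt := sqrtScale_le_cbrtScale hn hc hK h
  have hlin := linearScale_le_sqrtScale (ε := ε) hn hc hK ((le_div_pow_four hK hε hε1).trans h)
  have h0 := cbrtScale_nonneg (n := n) (ε := ε) hK
  refine max_le (le_mul_of_one_le_left h0 (one_le_pow₀ hc)) (max_le ?_ ?_)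
  · exact hsqrt.trans (by gcongr; exact le_self_pow₀ hc two_ne_zero)
  · calc linearScale K ε ≤ c * (c * cbrtScale n K ε) := hlin.trans (by gcongr)
      _ = c ^ 2 * cbrtScale n K ε := by ring

theorem sampleScale_le_sqrtScale (hn : 0 ≤ n) (hc : 1 ≤ c) (hK : 0 ≤ K) (h : K ≤ c * n)
    (h' : n ≤ c * (K / ε ^ 4)) : sampleScale n K ε ≤ c ^ 2 * sqrtScale n K ε := by
  have h0 := sqrtScale_nonneg (n := n) (K := K) (ε := ε)
  have hc2 : c * sqrtScale n K ε ≤ c ^ 2 * sqrtScale n K ε := by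
    gcongr
    exact le_self_pow₀ hc two_ne_zero
  exact max_le ((cbrtScale_le_sqrtScale hn hc hK h').trans hc2)
    (max_le (le_mul_of_one_le_left h0 (one_le_pow₀ hc))
      ((linearScale_le_sqrtScale hn hc hK h).trans hc2))

theorem sampleScale_le_linearScale (hn : 0 ≤ n) (hc : 1 ≤ c) (hK : 0 ≤ K) (hε : 0 < ε)
    (hε1 : ε ≤ 1) (h : n ≤ c * K) : sampleScale n K ε ≤ c ^ 2 * linearScale K ε := by
  have hsqrt := sqrtScale_le_linearScale (ε := ε) hn hc hK h
  have hcbrt : cbrtScale n K ε ≤ c * sqrtScale n K ε := cbrtScale_le_sqrtScale hn hc hK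
    (h.trans (by gcongr; exact le_div_pow_four hK hε hε1))
  have h0 := linearScale_nonneg (ε := ε) hK
  refine max_le ?_ (max_le ?_ (le_mul_of_one_le_left h0 (one_le_pow₀ hc)))
  · calc cbrtScale n K ε ≤ c * (c * linearScale K ε) := hcbrt.trans (by gcongr)
      _ = c ^ 2 * linearScale K ε := by ring
  · exact hsqrt.trans (by gcongr; exact le_self_pow₀ hc two_ne_zero)

variable {N B : ℝ}

theorem mul_le_of_mul_linearScale_le (hε : 0 < ε) (h : B * linearScale K ε ≤ N) :
    B * K ≤ N * ε ^ 2 := by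
  rwa [linearScale, mul_div_assoc', div_le_iff₀ (by positivity)] at h

theorem sq_mul_le_of_mul_sqrtScale_le (hB : 0 ≤ B) (hn : 0 ≤ n) (hK : 0 ≤ K) (hε : 0 < ε)
    (h : B * sqrtScale n K ε ≤ N) : B ^ 2 * (n * K) ≤ N ^ 2 * ε ^ 4 := by
  have hsq := pow_le_pow_left₀ (mul_nonneg hB sqrtScale_nonneg) h 2
  rwa [mul_pow, sqrtScale_sq hn hK, mul_div_assoc', mul_div_assoc',
    div_le_iff₀ (by positivity)] at hsq

theorem pow_three_mul_le_of_mul_cbrtScale_le (hB : 0 ≤ B) (hK : 0 ≤ K) (hε : 0 < ε)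
    (h : B * cbrtScale n K ε ≤ N) : B ^ 3 * (n ^ 2 * K) ≤ N ^ 3 * ε ^ 4 := by
  have hcube := pow_le_pow_left₀ (mul_nonneg hB (cbrtScale_nonneg hK)) h 3
  rwa [mul_pow, cbrtScale_pow_three hK, mul_div_assoc', div_le_iff₀ (by positivity)] at hcube

end Scales

section SampleSizes

variable {n c K ε N a m : ℝ}

theorem le_mul_min_mul (ha : 1 ≤ a) (hc : 1 ≤ c) (hn : 0 < n) (hK : 0 < K) (hε : 0 < ε)
    (hε1 : ε ≤ 1) (hN : 0 < N) (hNm : N ≤ m * K) (hlinear : a * c ^ 4 * linearScale K ε ≤ N)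
    (hsqrt : a * c ^ 4 * sqrtScale n K ε ≤ N) :
    a ≤ m * min N n * (ε ^ 2 / (c ^ 2 * n)) := by
  have hac : a * c ^ 2 ≤ a * c ^ 4 := by
    gcongr
    norm_num
  have hB : 1 ≤ a * c ^ 4 := one_le_mul_of_one_le_of_one_le ha (one_le_pow₀ hc)
  have hkey : a * (c ^ 2 * n) * K ≤ N * min N n * ε ^ 2 := by
    rcases min_choice N n with h | h <;> rw [h]
    · calc a * (c ^ 2 * n) * K = a * c ^ 2 * (n * K) := by ring
        _ ≤ (a * c ^ 4) ^ 2 * (n * K) := by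
          gcongr
          exact hac.trans (le_self_pow₀ hB two_ne_zero)
        _ ≤ N ^ 2 * ε ^ 4 :=
          sq_mul_le_of_mul_sqrtScale_le (zero_le_one.trans hB) hn.le hK.le hε hsqrt
        _ ≤ N ^ 2 * ε ^ 2 :=
          mul_le_mul_of_nonneg_left (pow_le_pow_of_le_one hε.le hε1 (by norm_num)) (sq_nonneg N)
        _ = N * N * ε ^ 2 := by ring
    · calc a * (c ^ 2 * n) * K = a * c ^ 2 * K * n := by ring
        _ ≤ a * c ^ 4 * K * n := by gcongr
        _ ≤ N * ε ^ 2 * n :=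
          mul_le_mul_of_nonneg_right (mul_le_of_mul_linearScale_le hε hlinear) hn.le
        _ = N * n * ε ^ 2 := by ring
  rw [mul_div_assoc', le_div_iff₀ (by positivity)]
  refine le_of_mul_le_mul_right ?_ hK
  calc a * (c ^ 2 * n) * K ≤ N * min N n * ε ^ 2 := hkey
    _ ≤ m * K * min N n * ε ^ 2 := by gcongr
    _ = m * min N n * ε ^ 2 * K := by ring

theorem le_mul_mul_min_mul_sq (ha : 1 ≤ a) (hc : 1 ≤ c) (hn : 0 < n) (hK : 0 < K) (hε : 0 < ε)
    (hN : 0 < N) (hNm : N ≤ m * K) (hsqrt : a * c ^ 4 * sqrtScale n K ε ≤ N)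
    (hcbrt : a * c ^ 4 * cbrtScale n K ε ≤ N) :
    a ≤ m * N * min N n * (ε ^ 2 / (c ^ 2 * n)) ^ 2 := by
  have hB : 1 ≤ a * c ^ 4 := one_le_mul_of_one_le_of_one_le ha (one_le_pow₀ hc)
  have hkey : a * (c ^ 2 * n) ^ 2 * K ≤ N * N * min N n * (ε ^ 2) ^ 2 := by
    rcases min_choice N n with h | h <;> rw [h]
    · calc a * (c ^ 2 * n) ^ 2 * K = a * c ^ 4 * (n ^ 2 * K) := by ring
        _ ≤ (a * c ^ 4) ^ 3 * (n ^ 2 * K) := by gcongr; exact le_self_pow₀ hB three_ne_zero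
        _ ≤ N ^ 3 * ε ^ 4 :=
          pow_three_mul_le_of_mul_cbrtScale_le (zero_le_one.trans hB) hK.le hε hcbrt
        _ = N * N * N * (ε ^ 2) ^ 2 := by ring
    · calc a * (c ^ 2 * n) ^ 2 * K = a * c ^ 4 * (n * K) * n := by ring
        _ ≤ (a * c ^ 4) ^ 2 * (n * K) * n := by gcongr; exact le_self_pow₀ hB two_ne_zero
        _ ≤ N ^ 2 * ε ^ 4 * n :=
          mul_le_mul_of_nonneg_right
            (sq_mul_le_of_mul_sqrtScale_le (zero_le_one.trans hB) hn.le hK.le hε hsqrt) hn.le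
        _ = N * N * n * (ε ^ 2) ^ 2 := by ring
  rw [div_pow, mul_div_assoc', le_div_iff₀ (by positivity)]
  refine le_of_mul_le_mul_right ?_ hK
  calc a * (c ^ 2 * n) ^ 2 * K ≤ N * N * min N n * (ε ^ 2) ^ 2 := hkey
    _ ≤ m * K * N * min N n * (ε ^ 2) ^ 2 := by gcongr
    _ = m * N * min N n * (ε ^ 2) ^ 2 * K := by ring

theorem eighteen_mul_le_two_pow {k : ℕ} (hk : 2 ≤ k) :
    18 * (k : ℝ) ≤ 2 ^ ⌈10 * Real.log k⌉₊ := by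
  have hk2 : (2 : ℝ) ≤ k := by exact_mod_cast hk
  have hlog : 0 < Real.log k := Real.log_pos (by linarith)
  have hlog2 := Real.log_two_gt_d9
  calc 18 * (k : ℝ) ≤ 2 ^ 5 * k := by linarith
    _ ≤ k ^ 5 * k := by gcongr
    _ = Real.exp (6 * Real.log k) := by
        rw [← Nat.cast_ofNat (n := 6), Real.exp_nat_mul, Real.exp_log (by positivity)]
        ring
    _ ≤ Real.exp (⌈10 * Real.log k⌉₊ * Real.log 2) := by
        refine Real.exp_le_exp.2 ?_
        calc 6 * Real.log k ≤ 10 * Real.log k * Real.log 2 := by nlinarith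
          _ ≤ ⌈10 * Real.log k⌉₊ * Real.log 2 := by gcongr; exact Nat.le_ceil _
    _ = 2 ^ ⌈10 * Real.log k⌉₊ := by rw [Real.exp_nat_mul, Real.exp_log (by norm_num)]

theorem one_le_mul_log {k : ℕ} (hk : 2 ≤ k) : 1 ≤ k * Real.log k := by
  have hk2 : (2 : ℝ) ≤ k := by exact_mod_cast hk
  calc (1 : ℝ) ≤ 2 * Real.log 2 := by linarith [Real.log_two_gt_d9]
    _ ≤ k * Real.log k := by gcongr

end SampleSizes

section TunedProcedure

theorem div_le_flatDistSq_of_le_mul_tvDist {n : ℕ} {c ε M : ℝ} (hc : 0 < c) (hε : 0 ≤ ε)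
    (hM : 0 ≤ M) (hMn : M ≤ n) {P Q : PMF (Fin n)} (hPQ : ε ≤ c * tvDist P Q) :
    ε ^ 2 / (c ^ 2 * n) ≤ flatDistSq P.toMeasure Q.toMeasure M := by
  have htv : ∑ i, |P.toMeasure.real {i} - Q.toMeasure.real {i}| = 2 * tvDist P Q := by
    simp only [measureReal_def, PMF.toMeasure_apply_singleton _ _ (measurableSet_singleton _),
      tvDist]
    ring
  have hCS := sq_sum_abs_sub_le (μ := P.toMeasure) (ν := Q.toMeasure) hM
  rw [htv, Fintype.card_fin] at hCS
  have hn : (0 : ℝ) < n := by exact_mod_cast Fin.pos P.support_nonempty.some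
  set S := flatDistSq P.toMeasure Q.toMeasure M
  have hS : 0 ≤ S := nonneg_of_mul_nonneg_left ((sq_nonneg _).trans hCS) (by positivity)
  rw [div_le_iff₀ (by positivity)]
  calc ε ^ 2 ≤ (c * tvDist P Q) ^ 2 := pow_le_pow_left₀ hε hPQ 2
    _ = c ^ 2 * ((2 * tvDist P Q) ^ 2 / 4) := by ring
    _ ≤ c ^ 2 * (S * (n + 2 * M) / 4) := by gcongr
    _ ≤ c ^ 2 * (S * (n + 3 * n) / 4) := by gcongr; linarith
    _ = S * (c ^ 2 * n) := by ring

/-- The learned procedure whose other parameters are adapted to the size `N` of the reference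
samples: the total number of samples is of order `N`, and `min N n` of the `N` pairs of reference
samples are used to flatten, on average. -/
noncomputable def tunedProcedure (n k N : ℕ) : ClassificationProcedure n k :=
  learnedProcedure n k N ⌈10 * Real.log k⌉₊ ⌈N / (k * Real.log k)⌉₊ (min 1 (n / N))

theorem le_successProb_tunedProcedure {n k N : ℕ} {c ε : ℝ} (hk : 2 ≤ k) (hc : 1 ≤ c)
    (hε : 0 < ε) (hε1 : ε ≤ 1)
    (hN : 10 ^ 15 * c ^ 4 * sampleScale n (k * Real.log k) ε ≤ N) {P Q : PMF (Fin n)}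
    (hPQ : ε ≤ c * tvDist P Q) {D : Fin k → PMF (Fin n)} (hD : ∀ i, D i = P ∨ D i = Q) :
    8 / 9 ≤ (tunedProcedure n k N).successProb P Q D := by
  set K : ℝ := k * Real.log k
  have hK1 : 1 ≤ K := one_le_mul_log hk
  have hK : 0 < K := by linarith
  have hn : (0 : ℝ) < n := by exact_mod_cast Fin.pos P.support_nonempty.some
  have hcbrt : 10 ^ 15 * c ^ 4 * cbrtScale n K ε ≤ N :=
    hN.trans' (by gcongr; exact le_max_left _ _)
  have hsqrt : 10 ^ 15 * c ^ 4 * sqrtScale n K ε ≤ N :=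
    hN.trans' (by gcongr; exact (le_max_left _ _).trans (le_max_right _ _))
  have hlinear : 10 ^ 15 * c ^ 4 * linearScale K ε ≤ N :=
    hN.trans' (by gcongr; exact (le_max_right _ _).trans (le_max_right _ _))
  have hN0 : (0 : ℝ) < N := hlinear.trans_lt' (by unfold linearScale; positivity)
  have hNm : (N : ℝ) ≤ ⌈N / K⌉₊ * K := (div_le_iff₀ hK).1 (Nat.le_ceil _)
  have hr : 0 < min 1 ((n : ℝ) / N) := lt_min one_pos (by positivity)
  have hM : min 1 ((n : ℝ) / N) * N = min (N : ℝ) n := by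
    rw [min_mul_of_nonneg _ _ hN0.le, one_mul, div_mul_cancel₀ _ hN0.ne']
  have hσ : ε ^ 2 / (c ^ 2 * n) ≤ flatDistSq P.toMeasure Q.toMeasure (min N n) :=
    div_le_flatDistSq_of_le_mul_tvDist (by linarith) hε.le (by positivity) (min_le_right _ _) hPQ
  refine le_successProb_learnedProcedure (Nat.ceil_pos.2 (by positivity)).ne'
    (Nat.ceil_le.2 (div_le_self hN0.le hK1)) hr (min_le_left _ _) (eighteen_mul_le_two_pow hk)
    ?_ ?_ ?_ hD <;> rw [hM]
  · exact hσ.trans_lt' (by positivity)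
  · exact (le_mul_min_mul (by norm_num) hc hn hK hε hε1 hN0 hNm hlinear hsqrt).trans (by gcongr)
  · exact (le_mul_mul_min_mul_sq (by norm_num) hc hn hK hε hN0 hNm hsqrt hcbrt).trans (by gcongr)

theorem ceil_le_two_mul {x : ℝ} (hx : 1 ≤ x) : (⌈x⌉₊ : ℝ) ≤ 2 * x := by
  linarith [Nat.ceil_lt_add_one (zero_le_one.trans hx)]

theorem sampleCount_tunedProcedure_le {n k N : ℕ} (hk : 2 ≤ k) (hN : k * Real.log k ≤ N) :
    ((tunedProcedure n k N).sampleCount : ℝ) ≤ 46 * N := by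
  have hK : 0 < k * Real.log k := zero_lt_one.trans_le (one_le_mul_log hk)
  have hlog : Real.log 2 ≤ Real.log k := by gcongr; exact_mod_cast hk
  have hL : (⌈10 * Real.log k⌉₊ : ℝ) ≤ 2 * (10 * Real.log k) :=
    ceil_le_two_mul (by linarith [Real.log_two_gt_d9])
  have hm : (⌈N / (k * Real.log k)⌉₊ : ℝ) ≤ 2 * (N / (k * Real.log k)) :=
    ceil_le_two_mul ((one_le_div hK).2 hN)
  simp only [ClassificationProcedure.sampleCount, tunedProcedure, learnedProcedure]
  push_cast
  calc 2 * (3 * (N : ℝ)) + k * (⌈10 * Real.log k⌉₊ * ⌈N / (k * Real.log k)⌉₊)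
      ≤ 2 * (3 * N) + k * (2 * (10 * Real.log k) * (2 * (N / (k * Real.log k)))) := by gcongr
    _ = 6 * N + 40 * (N / (k * Real.log k) * (k * Real.log k)) := by ring
    _ = 46 * N := by rw [div_mul_cancel₀ _ hK.ne']; ring

theorem exists_procedure_sampleCount_le (n : ℕ) {k : ℕ} {c ε : ℝ} (hk : 2 ≤ k) (hc : 1 ≤ c)
    (hε : 0 < ε) (hε1 : ε ≤ 1) :
    ∃ A : ClassificationProcedure n k,
      (∀ (P Q : PMF (Fin n)) (D : Fin k → PMF (Fin n)), ε ≤ c * tvDist P Q →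
        (∀ i, D i = P ∨ D i = Q) → 8 / 9 ≤ A.successProb P Q D) ∧
      (A.sampleCount : ℝ) ≤ 10 ^ 17 * c ^ 4 * sampleScale n (k * Real.log k) ε := by
  set K : ℝ := k * Real.log k
  have hK : 1 ≤ K := one_le_mul_log hk
  have hlinear : K ≤ sampleScale n K ε := calc
    K ≤ K / ε ^ 2 := le_div_self (by linarith) (by positivity) (pow_le_one₀ hε.le hε1)
    _ ≤ sampleScale n K ε := (le_max_right _ _).trans (le_max_right _ _)
  have hB : 1 ≤ 10 ^ 15 * c ^ 4 := one_le_mul_of_one_le_of_one_le (by norm_num) (one_le_pow₀ hc)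
  set N := ⌈10 ^ 15 * c ^ 4 * sampleScale n K ε⌉₊
  have hN : 10 ^ 15 * c ^ 4 * sampleScale n K ε ≤ N := Nat.le_ceil _
  have hKB : K ≤ 10 ^ 15 * c ^ 4 * sampleScale n K ε :=
    hlinear.trans (le_mul_of_one_le_left (by linarith) hB)
  refine ⟨tunedProcedure n k N, fun P Q D hPQ hD =>
    le_successProb_tunedProcedure hk hc hε hε1 hN hPQ hD, ?_⟩
  calc ((tunedProcedure n k N).sampleCount : ℝ) ≤ 46 * N :=
        sampleCount_tunedProcedure_le hk (hKB.trans hN)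
    _ ≤ 46 * (2 * (10 ^ 15 * c ^ 4 * sampleScale n K ε)) := by
        gcongr
        exact ceil_le_two_mul (hK.trans hKB)
    _ ≤ 10 ^ 17 * c ^ 4 * sampleScale n K ε := by linarith

end TunedProcedure

theorem theorem3p1 (c : ℝ) (hc : 0 < c) :
    ∃ C : ℝ, 0 < C ∧ ∀ (n k : ℕ) (ε : ℝ), 2 ≤ k → 0 < ε → ε ≤ 1 →
      ∃ A : ClassificationProcedure n k,
        (∀ (P Q : PMF (Fin n)) (D : Fin k → PMF (Fin n)),
          ε ≤ c * tvDist P Q → (∀ i, D i = P ∨ D i = Q) →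
            8 / 9 ≤ A.successProb P Q D) ∧
        (k * Real.log k / ε ^ 4 ≤ c * n →
          (A.sampleCount : ℝ) ≤ C * (n ^ 2 * k * Real.log k / ε ^ 4) ^ (1 / 3 : ℝ)) ∧
        (k * Real.log k ≤ c * n → n ≤ c * (k * Real.log k / ε ^ 4) →
          (A.sampleCount : ℝ) ≤ C * (Real.sqrt (n * k * Real.log k) / ε ^ 2)) ∧
        (n ≤ c * (k * Real.log k) →
          (A.sampleCount : ℝ) ≤ C * (k * Real.log k / ε ^ 2)) := by
  set b := max c 1
  have hb : 1 ≤ b := le_max_right _ _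
  have hle {x y : ℝ} (hy : 0 ≤ y) (h : x ≤ c * y) : x ≤ b * y :=
    h.trans (mul_le_mul_of_nonneg_right (le_max_left _ _) hy)
  refine ⟨10 ^ 17 * b ^ 4 * b ^ 2, by positivity, fun n k ε hk hε hε1 => ?_⟩
  obtain ⟨A, hA, hcount⟩ := exists_procedure_sampleCount_le n hk hb hε hε1
  have hK : 0 ≤ k * Real.log k := zero_le_one.trans (one_le_mul_log hk)
  have hn : (0 : ℝ) ≤ n := n.cast_nonneg
  have hscale {x : ℝ} (hx : sampleScale n (k * Real.log k) ε ≤ b ^ 2 * x) :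
      (A.sampleCount : ℝ) ≤ 10 ^ 17 * b ^ 4 * b ^ 2 * x := by
    rw [mul_assoc _ (b ^ 2)]
    exact hcount.trans (by gcongr)
  refine ⟨A, fun P Q D hPQ => hA P Q D (hle (by unfold tvDist; positivity) hPQ), fun h => ?_,
    fun h h' => ?_, fun h => ?_⟩
  · rw [mul_assoc _ (k : ℝ)]
    exact hscale (sampleScale_le_cbrtScale hn hb hK hε hε1 (hle hn h))
  · rw [mul_assoc _ (k : ℝ)]
    exact hscale (sampleScale_le_sqrtScale hn hb hK (hle hn h) (hle (by positivity) h'))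
  · exact hscale (sampleScale_le_linearScale hn hb hK hε hε1 (hle hK h))
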